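/- For a finite non-empty simple graph $G$ on $v(G)$ vertices, let $m_k(G)$ be the number of $k$-element sets of pairwise vertex-disjoint edges of $G$, let $$\mu(G,x)=\sum_{k=0}^{\lfloor v(G)/2\rfloor}(-1)^k m_k(G)\,x^{v(G)-2k}$$ be its matching polynomial, and let the matching measure $$\rho_G=\frac1{v(G)}\sum_{z:\ \mu(G,z)=0}\delta_z$$ be the uniform probability distribution on the (real) zeros of $\mu(G,x)$, taken with multiplicity. Let $d\ge 0$ and let $\mathbb{T}_d$ be the $d$-regular tree with a root $o$ (infinite for $d\ge 2$; a single edge for $d=1$, a single vertex for $d=0$). A sequence $(G_i)$ of finite non-empty graphs with uniformly bounded degrees Benjamini--Schramm converges to $\mathbb{T}_d$ if for every positive integer $r$ and every finite rooted graph $\alpha$, the probability that the $r$-ball around a uniformly random vertex of $G_i$ is isomorphic to $\alpha$ as a rooted graph tends to $1$ if the $r$-ball around $o$ in $\mathbb{T}_d$ is isomorphic to $\alpha$, and to $0$ otherwise. There is exactly one probability measure $\rho_{\mathbb{T}_d}$ on $\mathbb{R}$, called the matching measure of $\mathbb{T}_d$, such that $\rho_{G_i}\to\rho_{\mathbb{T}_d}$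 weakly for every sequence $(G_i)$ of finite non-empty graphs with uniformly bounded degrees that Benjamini--Schramm converges to $\mathbb{T}_d$. The function $|z|$ is integrable with respect to $\rho_{\mathbb{T}_d}$, and for every finite non-empty $d$-regular bipartite graph $G$, $$\int |z|\,d\rho_G(z)\ \ge\ \int |z|\,d\rho_{\mathbb{T}_d}(z).$$ (The left side is the matching energy of $G$, i.e. the sum of $|z|$ over the zeros $z$ of $\mu(G,x)$ with multiplicity, divided by $v(G)$.) -/

import Mathlib

open scoped ENNReal Topology Polynomial BoundedContinuousFunction
open MeasureTheory Filter

namespace MatchingEnergy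

universe u v

section FiniteGraphs

/-- `IsKMatching G k M`: `M` is a set of exactly `k` edges of `G` that pairwise share no vertex. -/
def IsKMatching {V : Type u} (G : SimpleGraph V) (k : ℕ) (M : Finset (Sym2 V)) : Prop :=
  (∀ e ∈ M, e ∈ G.edgeSet) ∧ M.card = k ∧
    ∀ e ∈ M, ∀ f ∈ M, e ≠ f → ∀ x : V, x ∈ e → x ∉ f

/-- `m_k(G)`, the number of `k`-matchings of `G`. -/
noncomputable def matchingCount {V : Type u} (G : SimpleGraph V) (k : ℕ) : ℕ :=
  Set.ncard {M : Finset (Sym2 V) | IsKMatching G k M}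

/-- The matching polynomial `μ(G,x) = ∑_{k ≤ v(G)/2} (-1)^k m_k(G) x^(v(G) - 2k)`. -/
noncomputable def matchingPoly {V : Type u} [Fintype V] (G : SimpleGraph V) : ℝ[X] :=
  ∑ k ∈ Finset.range (Fintype.card V / 2 + 1),
    Polynomial.C ((-1 : ℝ) ^ k * (matchingCount G k : ℝ)) *
      Polynomial.X ^ (Fintype.card V - 2 * k)

/-- The matching measure `ρ_G`: the normalized sum of the Dirac masses at the zeros of `μ(G,x)`,
counted with multiplicity. All zeros are real (Heilmann and Lieb), and `μ(G,x)` is monic of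
degree `v(G)`, so this is the uniform distribution on all the `v(G)` zeros. -/
noncomputable def matchingMeasure {V : Type u} [Fintype V] (G : SimpleGraph V) : Measure ℝ :=
  (Fintype.card V : ℝ≥0∞)⁻¹ • ((matchingPoly G).roots.map fun z => Measure.dirac z).sum

end FiniteGraphs

section LocalConvergence

/-- The vertex set of the ball of radius `r` around `o`. -/
def closedBall {V : Type u} (G : SimpleGraph V) (o : V) (r : ℕ) : Set V :=
  {x | G.edist o x ≤ r}

/-- The `r`-ball of `G` centered at `o`, as an induced subgraph rooted at `o`, is isomorphic (as a
rooted graph) to the graph `A` rooted at `a`. -/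
def BallIso {V : Type u} (G : SimpleGraph V) (o : V) (r : ℕ)
    {α : Type v} (A : SimpleGraph α) (a : α) : Prop :=
  ∃ φ : G.induce (closedBall G o r) ≃g A, ∀ x : closedBall G o r, (x : V) = o → φ x = a

/-- `ℙ(G, A, r)`: the probability that the `r`-ball centered at a uniform random vertex of the
finite graph `G` is isomorphic to the rooted graph `(A, a)`. -/
noncomputable def ballProb {V : Type u} [Fintype V] (G : SimpleGraph V) (r : ℕ)
    {α : Type v} (A : SimpleGraph α) (a : α) : ℝ :=
  (Set.ncard {o : V | BallIso G o r A a} : ℝ) / (Fintype.card V : ℝ)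

open Classical in
/-- Benjamini-Schramm convergence of a sequence of finite graphs with uniformly bounded degrees to
the (deterministic) rooted graph `(T, o)`, that is, to the random rooted graph that is `(T, o)`
with probability one. Finite rooted graphs are taken on the vertex sets `Fin n`. -/
def BSConverges {V : ℕ → Type} [∀ i, Fintype (V i)] (G : ∀ i, SimpleGraph (V i))
    {W : Type v} (T : SimpleGraph W) (o : W) : Prop :=
  (∃ D : ℕ, ∀ i, ∀ x : V i, ((G i).neighborSet x).ncard ≤ D) ∧
    ∀ r : ℕ, 0 < r → ∀ (n : ℕ) (A : SimpleGraph (Fin n)) (a : Fin n),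
      Tendsto (fun i => ballProb (G i) r A a) atTop (𝓝 (if BallIso T o r A a then 1 else 0))

/-- `ρ` is the matching measure of the rooted graph `(T, o)`: a probability measure which is the
weak limit of the matching measures `ρ_{G_i}` for every bounded degree sequence `(G_i)` of finite
non-empty graphs that is Benjamini-Schramm convergent to `(T, o)`. -/
def IsLimitMatchingMeasure {W : Type v} (T : SimpleGraph W) (o : W) (ρ : Measure ℝ) : Prop :=
  IsProbabilityMeasure ρ ∧
    ∀ (V : ℕ → Type) [∀ i, Fintype (V i)] [∀ i, Nonempty (V i)] (G : ∀ i, SimpleGraph (V i)),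
      BSConverges G T o →
        ∀ f : ℝ →ᵇ ℝ,
          Tendsto (fun i => ∫ z, f z ∂(matchingMeasure (G i))) atTop (𝓝 (∫ z, f z ∂ρ))

end LocalConvergence

section RegularTree

/-- Words over an alphabet of `d` letters in which consecutive letters are different. -/
abbrev ReducedWord (d : ℕ) : Type :=
  {w : List (Fin d) // w.IsChain (· ≠ ·)}

/-- The `d`-regular tree `𝕋_d`: two reduced words are adjacent when one arises from the other by
adding one letter in front. The empty word has the `d` one-letter words as neighbours; a non-empty
word has its tail and the `d - 1` extensions by a letter other than its first one. -/
def regularTree (d : ℕ) : SimpleGraph (ReducedWord d) where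
  Adj w w' := (∃ a, w'.1 = a :: w.1) ∨ (∃ a, w.1 = a :: w'.1)
  symm := ⟨fun _ _ h => h.symm⟩
  loopless := ⟨fun w h => by
    rcases h with ⟨a, h⟩ | ⟨a, h⟩ <;> exact absurd (congrArg List.length h) (by simp)⟩

/-- The root of `𝕋_d`: the empty word. -/
def regularTreeRoot (d : ℕ) : ReducedWord d := ⟨[], List.IsChain.nil⟩

end RegularTree

end MatchingEnergy

/-!
Let `G` be a finite `d`-regular graph. The quotients `R(G, v) = μ(G - v, x) / μ(G, x)` satisfy the
recursion `R(G, v) = 1 / (x - ∑ R(G - v, u))`, the sum being over the neighbours `u` of `v`. It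
has two consequences. For `x` in the upper half plane it keeps the quotients in the lower half
plane, and for real `x` of modulus larger than the degrees it keeps them bounded by `1`; so all
zeros of `μ(G, x)` are real and bounded in terms of the maximal degree (`splits_matchingPoly`,
`abs_le_of_mem_roots`). And for large real `x` it is a contraction, so that `R(G, v)` is
determined up to an exponentially small error by the `r`-ball around `v`
(`abs_delRatio_sub_truncRatio_le`, `truncRatio_eq_of_ballIso`). As `μ' = ∑ μ(G - v, x)`, the
average of `R(G, v)` over `v` is the Stieltjes transform of the matching measure
(`integral_stieltjes`). Hence two sequences with the same Benjamini-Schramm limit have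
asymptotically equal Stieltjes transforms near infinity, therefore equal moments, and by
Weierstrass' theorem asymptotically equal integrals of all continuous functions
(`agreesOn_of_bsConverges`). Prokhorov's theorem provides a limit measure along one sequence,
which then serves for all of them (`existsUnique_isLimitMatchingMeasure`).

For this at least one sequence converging to `𝕋_d` is needed. The cover of `G` with voltage group
`(ℤ/2)^E`, every edge having its own coordinate, has larger girth than `G`
(`NoShortCycle.signedLift`), and `d`-regular graphs of large girth have the same balls as `𝕋_d`,
as is seen from the covering map from `𝕋_d` (`exists_ball_iso`).

These covers are towers of two-fold covers. If `G` is bipartite and `H` is a two-fold cover of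
`G`, then the matching generating function `M(H, t) = ∑ m_k(H) t^k` is at most `M(G, t)^2`, the
one of the trivial cover (`partFun_twoLift_le`). Indeed, among the matchings of `H` with a given
projection to `G`, those edges that are covered once form a bipartite graph of maximal degree two,
and the choices of their lifts are the solutions of an inhomogeneous linear system over `ℤ/2`. The
trivial cover leads to the same system with another right hand side, for which a proper
2-edge-colouring is a solution, so it has at least as many solutions. By the Coulson integral
formula `π |z| = ∫ log (1 + t² z²) / t² dt` and `∏ (1 + t² z²) = M(G, t²)²`, the normalized
matching energy does not increase in the tower (`integral_abs_signedLift_le`), and its terms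
converge to `𝕋_d`.
-/

namespace MatchingEnergy
universe u v w

/-! ### The matching partition function and the matching polynomial -/

section PartitionFunction

/-- `M` is a matching of `G` all of whose edges lie inside the vertex set `S`. -/
def IsMatchingIn {V : Type u} (G : SimpleGraph V) (S : Finset V) (M : Finset (Sym2 V)) : Prop :=
  (∀ e ∈ M, e ∈ G.edgeSet ∧ ∀ x ∈ e, x ∈ S) ∧ ∀ e ∈ M, ∀ f ∈ M, e ≠ f → ∀ x : V, x ∈ e → x ∉ f

variable {V : Type u} [Fintype V] (G : SimpleGraph V)

open Classical in
/-- The finset of all matchings of `G` inside `S`. -/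
noncomputable def matchingsIn (S : Finset V) : Finset (Finset (Sym2 V)) :=
  Finset.univ.filter (IsMatchingIn G S)

open Classical in
/-- The vertices of `S` that are missed by `M`. -/
noncomputable def uncovered (S : Finset V) (M : Finset (Sym2 V)) : Finset V :=
  S.filter fun v => ∀ e ∈ M, v ∉ e

/-- The homogeneous matching partition function of the subgraph induced on `S`: a matching
contributes a factor `x` for every vertex of `S` it misses and a factor `y` for every edge.
For `y = -1` this is the matching polynomial, for `x = 1` the matching generating function. -/
noncomputable def partFun {R : Type*} [CommSemiring R] (x y : R) (S : Finset V) : R :=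
  ∑ M ∈ matchingsIn G S, x ^ (uncovered S M).card * y ^ M.card

open Classical in
/-- The neighbours of `v` that lie in `S`. -/
noncomputable def nbrsIn {V : Type u} (G : SimpleGraph V) (S : Finset V) (v : V) :
    Finset V :=
  S.filter fun u => G.Adj v u

variable {G}

@[simp] lemma mem_matchingsIn {S : Finset V} {M : Finset (Sym2 V)} :
    M ∈ matchingsIn G S ↔ IsMatchingIn G S M := by
  simp [matchingsIn]

@[simp] lemma mem_uncovered {S : Finset V} {M : Finset (Sym2 V)} {v : V} :
    v ∈ uncovered S M ↔ v ∈ S ∧ ∀ e ∈ M, v ∉ e := by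
  simp [uncovered]

@[simp] lemma mem_nbrsIn {V : Type u} {G : SimpleGraph V} {S : Finset V} {u v : V} :
    u ∈ nbrsIn G S v ↔ u ∈ S ∧ G.Adj v u := by
  simp [nbrsIn]

lemma map_partFun {R R' : Type*} [CommSemiring R] [CommSemiring R'] (φ : R →+* R') (x y : R)
    (S : Finset V) : φ (partFun G x y S) = partFun G (φ x) (φ y) S := by
  simp [partFun]

lemma partFun_empty {R : Type*} [CommSemiring R] (x y : R) : partFun G x y ∅ = 1 := by
  have h : matchingsIn G (∅ : Finset V) = {∅} := by
    ext M
    simp only [mem_matchingsIn, Finset.mem_singleton]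
    constructor
    · intro h
      refine Finset.eq_empty_of_forall_notMem fun e he => ?_
      induction e with
      | _ a b => simpa using (h.1 _ he).2 a
    · rintro rfl
      simp [IsMatchingIn]
  rw [partFun, h]
  simp [uncovered]

open Classical in
/-- The matchings containing the edge `vu` correspond to the matchings of `S ∖ {v, u}`. -/
lemma sum_matchings_containing {R : Type*} [CommSemiring R] (x y : R) {S : Finset V} {v u : V}
    (hv : v ∈ S) (hu : u ∈ S) (huv : G.Adj v u) :
    ∑ M ∈ matchingsIn G S with s(v, u) ∈ M, x ^ (uncovered S M).card * y ^ M.card =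
      y * partFun G x y ((S.erase v).erase u) := by
  rw [partFun, Finset.mul_sum]
  refine Finset.sum_bij' (fun M _ => M.erase s(v, u)) (fun M _ => insert s(v, u) M) ?_ ?_ ?_ ?_ ?_
  · intro M hM
    simp only [Finset.mem_filter, mem_matchingsIn] at hM ⊢
    obtain ⟨⟨h1, h2⟩, h3⟩ := hM
    refine ⟨fun e he => ?_, fun e he f hf => h2 e (Finset.mem_of_mem_erase he) f
      (Finset.mem_of_mem_erase hf)⟩
    have he' := Finset.mem_of_mem_erase he
    have hne := Finset.ne_of_mem_erase he
    refine ⟨(h1 e he').1, fun z hz => ?_⟩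
    have h4 := h2 e he' _ h3 hne z hz
    simp only [Sym2.mem_iff, not_or] at h4
    simp [h4, (h1 e he').2 z hz]
  · intro M hM
    simp only [Finset.mem_filter, mem_matchingsIn] at hM ⊢
    obtain ⟨h1, h2⟩ := hM
    have key : ∀ e ∈ M, ∀ z ∈ e, z ∉ s(v, u) := by
      intro e he z hz
      have := (h1 e he).2 z hz
      simp only [Finset.mem_erase] at this
      simp [this.1, this.2.1]
    refine ⟨⟨fun e he => ?_, ?_⟩, Finset.mem_insert_self _ _⟩
    · rcases Finset.mem_insert.1 he with rfl | he
      · simp [huv, hv, hu]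
      · exact ⟨(h1 e he).1, fun z hz =>
          Finset.mem_of_mem_erase (Finset.mem_of_mem_erase ((h1 e he).2 z hz))⟩
    · intro e he f hf hne z hz hz'
      rcases Finset.mem_insert.1 he with rfl | he <;> rcases Finset.mem_insert.1 hf with rfl | hf
      · exact hne rfl
      · exact key f hf z hz' hz
      · exact key e he z hz hz'
      · exact h2 e he f hf hne z hz hz'
  · intro M hM
    simp only [Finset.mem_filter, mem_matchingsIn] at hM
    exact Finset.insert_erase hM.2
  · intro M hM
    simp only [mem_matchingsIn] at hM
    refine Finset.erase_insert fun h => ?_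
    simpa using (hM.1 _ h).2 u
  · intro M hM
    simp only [Finset.mem_filter, mem_matchingsIn] at hM
    obtain ⟨⟨h1, h2⟩, h3⟩ := hM
    have hun : uncovered S M = uncovered ((S.erase v).erase u) (M.erase s(v, u)) := by
      ext z
      simp only [mem_uncovered, Finset.mem_erase]
      constructor
      · rintro ⟨hz, h⟩
        have := h _ h3
        simp only [Sym2.mem_iff, not_or] at this
        exact ⟨⟨this.2, this.1, hz⟩, fun e he => h e he.2⟩
      · rintro ⟨⟨hzu, hzv, hz⟩, h⟩
        refine ⟨hz, fun e he => ?_⟩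
        by_cases hee : e = s(v, u)
        · subst hee; simp [hzu, hzv]
        · exact h e ⟨hee, he⟩
    rw [hun, ← Finset.card_erase_add_one h3, pow_succ]
    ring

open Classical in
/-- The vertex deletion recurrence: `v` is either missed or matched to one of its neighbours. -/
lemma partFun_rec {R : Type*} [CommSemiring R] (x y : R) {S : Finset V} {v : V} (hv : v ∈ S) :
    partFun G x y S = x * partFun G x y (S.erase v) +
      y * ∑ u ∈ nbrsIn G (S.erase v) v, partFun G x y ((S.erase v).erase u) := by
  have h1 : ∑ M ∈ matchingsIn G S with (∀ e ∈ M, v ∉ e), x ^ (uncovered S M).card * y ^ M.card =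
      x * partFun G x y (S.erase v) := by
    rw [partFun, Finset.mul_sum]
    have hset : (matchingsIn G S).filter (fun M => ∀ e ∈ M, v ∉ e) =
        matchingsIn G (S.erase v) := by
      ext M
      simp only [Finset.mem_filter, mem_matchingsIn, IsMatchingIn, Finset.mem_erase]
      constructor
      · rintro ⟨⟨h1, h2⟩, h3⟩
        exact ⟨fun e he => ⟨(h1 e he).1, fun z hz =>
          ⟨fun h => h3 e he (h ▸ hz), (h1 e he).2 z hz⟩⟩, h2⟩
      · rintro ⟨h1, h2⟩
        exact ⟨⟨fun e he => ⟨(h1 e he).1, fun z hz => ((h1 e he).2 z hz).2⟩, h2⟩,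
          fun e he hve => ((h1 e he).2 v hve).1 rfl⟩
    rw [hset]
    refine Finset.sum_congr rfl fun M hM => ?_
    have hM' : ∀ e ∈ M, v ∉ e := by
      rw [← hset] at hM
      exact (Finset.mem_filter.1 hM).2
    have : uncovered S M = insert v (uncovered (S.erase v) M) := by
      ext z
      simp only [mem_uncovered, Finset.mem_insert, Finset.mem_erase]
      by_cases hz : z = v
      · subst hz; simpa [hv] using hM'
      · simp [hz]
    rw [this, Finset.card_insert_of_notMem (by simp), pow_succ]
    ring
  have h2 : ∑ M ∈ matchingsIn G S with ¬ (∀ e ∈ M, v ∉ e),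
      x ^ (uncovered S M).card * y ^ M.card =
      ∑ u ∈ nbrsIn G (S.erase v) v,
        ∑ M ∈ matchingsIn G S with s(v, u) ∈ M, x ^ (uncovered S M).card * y ^ M.card := by
    rw [← Finset.sum_biUnion]
    · refine Finset.sum_congr ?_ fun _ _ => rfl
      ext M
      simp only [Finset.mem_filter, mem_matchingsIn, Finset.mem_biUnion, mem_nbrsIn]
      constructor
      · rintro ⟨hM, h⟩
        push Not at h
        obtain ⟨e, he, hve⟩ := h
        obtain ⟨u, rfl⟩ := hve
        have h3 := hM.1 _ he
        have hadj : G.Adj v u := by simpa using h3.1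
        exact ⟨u, ⟨by simp [hadj.ne', h3.2 u], hadj⟩, hM, he⟩
      · rintro ⟨u, _, hM, he⟩
        exact ⟨hM, fun h => h _ he (by simp)⟩
    · intro u _ u' _ huu
      refine Finset.disjoint_left.2 fun M hM hM' => ?_
      simp only [Finset.mem_filter, mem_matchingsIn] at hM hM'
      exact hM.1.2 _ hM.2 _ hM'.2 (fun h => huu (Sym2.congr_right.1 h)) v (by simp)
        (by simp)
  rw [partFun, ← Finset.sum_filter_add_sum_filter_not _ (fun M => ∀ e ∈ M, v ∉ e), h1, h2,
    Finset.mul_sum]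
  congr 1
  refine Finset.sum_congr rfl fun u hu => ?_
  simp only [mem_nbrsIn, Finset.mem_erase] at hu
  exact sum_matchings_containing x y hv hu.1.2 hu.2

open Classical in
/-- A matching with `k` edges covers exactly `2k` vertices. -/
lemma card_uncovered_add {M : Finset (Sym2 V)} (hM : IsMatchingIn G Finset.univ M) :
    (uncovered Finset.univ M).card + 2 * M.card = Fintype.card V := by
  have h : (uncovered Finset.univ M)ᶜ = M.biUnion Sym2.toFinset := by
    ext z; simp
  have h2 : (M.biUnion Sym2.toFinset).card = 2 * M.card := by
    rw [Finset.card_biUnion]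
    · rw [Finset.sum_congr rfl fun e he => Sym2.card_toFinset_of_not_isDiag e
        (G.not_isDiag_of_mem_edgeSet (hM.1 e he).1)]
      simp [mul_comm]
    · intro e he f hf hef
      refine Finset.disjoint_left.2 fun z hz hz' => ?_
      exact hM.2 e he f hf hef z (by simpa using hz) (by simpa using hz')
  rw [← h2, ← h, Finset.card_add_card_compl]

open Classical in
lemma sum_matchings_univ_eq {R : Type*} [CommSemiring R] (x y : R) :
    partFun G x y Finset.univ = ∑ k ∈ Finset.range (Fintype.card V / 2 + 1),
      (matchingCount G k : R) * (x ^ (Fintype.card V - 2 * k) * y ^ k) := by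
  rw [partFun, ← Finset.sum_fiberwise_of_maps_to (g := Finset.card)
    (t := Finset.range (Fintype.card V / 2 + 1))]
  · refine Finset.sum_congr rfl fun k _ => ?_
    have hk : {M : Finset (Sym2 V) | IsKMatching G k M} =
        ↑((matchingsIn G Finset.univ).filter fun M => M.card = k) := by
      ext M
      simp only [Set.mem_ofPred_eq, IsKMatching, Finset.coe_filter, mem_matchingsIn, IsMatchingIn,
        Finset.mem_univ, implies_true, and_true]
      tauto
    rw [matchingCount, hk, Set.ncard_coe_finset, ← nsmul_eq_mul, ← Finset.sum_const]
    refine Finset.sum_congr rfl fun M hM => ?_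
    obtain ⟨hM', rfl⟩ := Finset.mem_filter.1 hM
    rw [← card_uncovered_add (mem_matchingsIn.1 hM'), Nat.add_sub_cancel]
  · intro M hM
    have := card_uncovered_add (mem_matchingsIn.1 hM)
    simp only [Finset.mem_range]
    omega

lemma matchingPoly_eq_partFun : matchingPoly G = partFun G Polynomial.X (-1) Finset.univ := by
  rw [matchingPoly, sum_matchings_univ_eq]
  refine Finset.sum_congr rfl fun k _ => ?_
  simp
  ring

/-- The value of the matching polynomial in an `ℝ`-algebra. -/
lemma aeval_matchingPoly {A : Type*} [CommRing A] [Algebra ℝ A] (x : A) :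
    Polynomial.aeval x (matchingPoly G) = partFun G x (-1) Finset.univ := by
  rw [matchingPoly_eq_partFun, ← AlgHom.coe_toRingHom, map_partFun]
  simp

lemma eval_matchingPoly (x : ℝ) :
    (matchingPoly G).eval x = partFun G x (-1) Finset.univ := by
  rw [← aeval_matchingPoly x, Polynomial.coe_aeval_eq_eval]

open Classical in
/-- Differentiating the matching polynomial amounts to deleting a vertex in all possible ways. -/
lemma derivative_matchingPoly : (matchingPoly G).derivative =
    ∑ v, partFun G (Polynomial.X : ℝ[X]) (-1) (Finset.univ.erase v) := by
  suffices h : ∀ S : Finset V, (partFun G (Polynomial.X : ℝ[X]) (-1) S).derivative =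
      ∑ v ∈ S, partFun G (Polynomial.X : ℝ[X]) (-1) (S.erase v) by
    rw [matchingPoly_eq_partFun, h]
  intro S
  induction S using Finset.strongInduction with
  | _ S ih =>
    rcases S.eq_empty_or_nonempty with rfl | ⟨v, hv⟩
    · simp [partFun_empty]
    · have key : ∀ w ∈ S.erase v, partFun G (Polynomial.X : ℝ[X]) (-1) (S.erase w) =
          Polynomial.X * partFun G (Polynomial.X : ℝ[X]) (-1) ((S.erase v).erase w) +
          (-1) * ∑ u ∈ nbrsIn G ((S.erase v).erase w) v,
            partFun G (Polynomial.X : ℝ[X]) (-1) (((S.erase v).erase w).erase u) := by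
        intro w hw
        have : v ∈ S.erase w :=
          Finset.mem_erase.2 ⟨(Finset.ne_of_mem_erase hw).symm, hv⟩
        rw [partFun_rec _ _ this, Finset.erase_right_comm]
      have hswap : ∑ w ∈ S.erase v, ∑ u ∈ nbrsIn G ((S.erase v).erase w) v,
            partFun G (Polynomial.X : ℝ[X]) (-1) (((S.erase v).erase w).erase u) =
          ∑ u ∈ nbrsIn G (S.erase v) v, ∑ w ∈ (S.erase v).erase u,
            partFun G (Polynomial.X : ℝ[X]) (-1) (((S.erase v).erase u).erase w) := by
        refine (Finset.sum_comm' ?_).trans (Finset.sum_congr rfl fun u _ =>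
          Finset.sum_congr rfl fun w _ => by rw [Finset.erase_right_comm])
        intro w u
        simp only [mem_nbrsIn, Finset.mem_erase]
        tauto
      rw [← Finset.add_sum_erase _ _ hv, Finset.sum_congr rfl key, Finset.sum_add_distrib,
        ← Finset.mul_sum, ← Finset.mul_sum, hswap, partFun_rec _ _ hv]
      simp only [Polynomial.derivative_add, Polynomial.derivative_mul, Polynomial.derivative_X,
        Polynomial.derivative_neg, Polynomial.derivative_one, Polynomial.derivative_sum]
      rw [ih _ (Finset.erase_ssubset hv), Finset.sum_congr rfl fun u hu =>
        ih ((S.erase v).erase u) (((S.erase v).erase_subset u).trans_ssubset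
          (Finset.erase_ssubset hv))]
      ring

end PartitionFunction

/-! ### Zeros of the matching polynomial: the Heilmann-Lieb theorem -/

section HeilmannLieb

variable {V : Type u} [Fintype V] {G : SimpleGraph V}

open Classical in
lemma partFun_div_erase {K : Type*} [Field K] (x : K) {S : Finset V} {v : V} (hv : v ∈ S)
    (h : partFun G x (-1) (S.erase v) ≠ 0) :
    partFun G x (-1) S / partFun G x (-1) (S.erase v) = x - ∑ u ∈ nbrsIn G (S.erase v) v,
      partFun G x (-1) ((S.erase v).erase u) / partFun G x (-1) (S.erase v) := by
  rw [partFun_rec _ _ hv, ← Finset.sum_div]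
  field_simp
  ring

open Classical in
/-- The Heilmann-Lieb theorem: the quotient by the value at a vertex-deleted subgraph maps
the upper half plane to itself, so the matching polynomial has no zero there. -/
lemma partFun_ne_zero_of_im_pos {x : ℂ} (hx : 0 < x.im) (S : Finset V) :
    partFun G x (-1) S ≠ 0 ∧
      ∀ v ∈ S, 0 < (partFun G x (-1) S / partFun G x (-1) (S.erase v)).im := by
  induction S using Finset.strongInduction with
  | _ S ih =>
    have key : ∀ v ∈ S, 0 < (partFun G x (-1) S / partFun G x (-1) (S.erase v)).im := by
      intro v hv
      obtain ⟨h1, h2⟩ := ih _ (Finset.erase_ssubset hv)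
      rw [partFun_div_erase x hv h1, Complex.sub_im, Complex.im_sum]
      have : ∑ u ∈ nbrsIn G (S.erase v) v,
          (partFun G x (-1) ((S.erase v).erase u) / partFun G x (-1) (S.erase v)).im ≤ 0 := by
        refine Finset.sum_nonpos fun u hu => ?_
        have h3 := h2 u (mem_nbrsIn.1 hu).1
        rw [← inv_div, Complex.inv_im]
        exact div_nonpos_of_nonpos_of_nonneg (by linarith) (Complex.normSq_nonneg _)
      linarith
    refine ⟨?_, key⟩
    rcases S.eq_empty_or_nonempty with rfl | ⟨v, hv⟩
    · simp [partFun_empty]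
    · intro h
      simpa [h] using key v hv

variable (G) in
/-- Every vertex of `G` has at most `D` neighbours. -/
def DegreeLE (D : ℕ) : Prop := ∀ v, (nbrsIn G Finset.univ v).card ≤ D

lemma DegreeLE.card_nbrsIn_le {D : ℕ} (hD : DegreeLE G D) (S : Finset V) (v : V) :
    ((nbrsIn G S v).card : ℝ) ≤ D := by
  refine Nat.cast_le.2 ((Finset.card_le_card fun u hu => ?_).trans (hD v))
  simp only [mem_nbrsIn] at hu ⊢
  simp [hu.2]

open Classical in
/-- `μ(G[S ∖ v], x) / μ(G[S], x)`; up to normalization its expansion in `1 / x` counts the closed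
tree-like walks from `v`. -/
noncomputable def delRatio (G : SimpleGraph V) (x : ℝ) (S : Finset V) (v : V) : ℝ :=
  partFun G x (-1) (S.erase v) / partFun G x (-1) S

/-- A sum over neighbours of terms of modulus at most one is bounded by the degree bound. -/
lemma DegreeLE.abs_sum_le {D : ℕ} (hD : DegreeLE G D) (S : Finset V) (v : V) {f : V → ℝ} {c : ℝ}
    (hc : 0 ≤ c) (hf : ∀ u ∈ nbrsIn G S v, |f u| ≤ c) : |∑ u ∈ nbrsIn G S v, f u| ≤ D * c := by
  refine (Finset.abs_sum_le_sum_abs _ _).trans ((Finset.sum_le_sum hf).trans ?_)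
  rw [Finset.sum_const, nsmul_eq_mul]
  exact mul_le_mul_of_nonneg_right (hD.card_nbrsIn_le S v) hc

open Classical in
lemma partFun_ne_zero_of_le_abs {D : ℕ} (hD : DegreeLE G D) {x : ℝ} (hx : (D : ℝ) + 1 ≤ |x|)
    (S : Finset V) : partFun G x (-1) S ≠ 0 ∧ ∀ v ∈ S, |delRatio G x S v| ≤ 1 := by
  induction S using Finset.strongInduction with
  | _ S ih =>
    have key : ∀ v ∈ S, 1 ≤ |partFun G x (-1) S / partFun G x (-1) (S.erase v)| := by
      intro v hv
      obtain ⟨h1, h2⟩ := ih _ (Finset.erase_ssubset hv)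
      rw [partFun_div_erase x hv h1]
      have h3 := hD.abs_sum_le (S.erase v) v (f := delRatio G x (S.erase v)) zero_le_one
        fun u hu => h2 u (mem_nbrsIn.1 hu).1
      have h4 := abs_sub_abs_le_abs_sub x (∑ u ∈ nbrsIn G (S.erase v) v, delRatio G x (S.erase v) u)
      simp only [delRatio] at h3 h4
      linarith
    constructor
    · rcases S.eq_empty_or_nonempty with rfl | ⟨v, hv⟩
      · simp [partFun_empty]
      · intro h
        have := key v hv
        norm_num [h] at this
    · intro v hv
      rw [delRatio, ← inv_div, abs_inv]
      exact inv_le_one_of_one_le₀ (key v hv)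

open Classical in
lemma delRatio_eq {D : ℕ} (hD : DegreeLE G D) {x : ℝ} (hx : (D : ℝ) + 1 ≤ |x|)
    {S : Finset V} {v : V} (hv : v ∈ S) :
    delRatio G x S v = 1 / (x - ∑ u ∈ nbrsIn G (S.erase v) v, delRatio G x (S.erase v) u) := by
  have h := partFun_div_erase (G := G) x hv (partFun_ne_zero_of_le_abs hD hx _).1
  simp only [delRatio]
  rw [← h, one_div_div]

end HeilmannLieb

/-! ### The matching measure and its Stieltjes transform -/

section Roots

variable {V : Type u} [Fintype V] (G : SimpleGraph V)

lemma matchingCount_zero {V : Type u} (G : SimpleGraph V) : matchingCount G 0 = 1 := by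
  rw [matchingCount, Set.ncard_eq_one]
  refine ⟨∅, ?_⟩
  ext M
  simp only [IsKMatching, Finset.card_eq_zero, Set.mem_ofPred_eq, Set.mem_singleton_iff]
  constructor
  · exact fun h => h.2.1
  · rintro rfl; simp

lemma exists_matchingPoly_eq : ∃ p : ℝ[X], p.degree < (Fintype.card V : ℕ) ∧
    matchingPoly G = Polynomial.X ^ Fintype.card V + p := by
  refine ⟨_, ?_, by
    rw [matchingPoly, Finset.sum_range_succ', add_comm]
    simp only [matchingCount_zero G, pow_zero, Nat.cast_one, mul_one, map_one, one_mul, mul_zero,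
      Nat.sub_zero]
    rfl⟩
  refine (Polynomial.degree_sum_le _ _).trans_lt ?_
  refine (Finset.sup_lt_iff (WithBot.bot_lt_coe _)).2 fun k hk => ?_
  refine (Polynomial.degree_C_mul_X_pow_le _ _).trans_lt ?_
  simp only [Finset.mem_range] at hk
  exact WithBot.coe_lt_coe.2 (by simp; omega)

lemma monic_matchingPoly : (matchingPoly G).Monic := by
  obtain ⟨p, hp, h⟩ := exists_matchingPoly_eq G
  rw [h]
  exact Polynomial.monic_X_pow_add hp

lemma natDegree_matchingPoly : (matchingPoly G).natDegree = Fintype.card V := by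
  obtain ⟨p, hp, h⟩ := exists_matchingPoly_eq G
  rw [h, Polynomial.natDegree_add_eq_left_of_degree_lt (by simpa using hp)]
  simp

lemma splits_matchingPoly : (matchingPoly G).Splits := by
  refine Polynomial.Splits.of_splits_map (algebraMap ℝ ℂ) (IsAlgClosed.splits _) fun z hz => ?_
  have hz0 : Polynomial.aeval z (matchingPoly G) = 0 := by
    have := Polynomial.isRoot_of_mem_roots hz
    rwa [Polynomial.IsRoot, Polynomial.eval_map_algebraMap] at this
  suffices h : z.im = 0 from ⟨z.re, Complex.ext (by simp) (by simp [h])⟩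
  by_contra h
  rcases lt_or_gt_of_ne h with h | h
  · have h1 : Polynomial.aeval (starRingEnd ℂ z) (matchingPoly G) = 0 := by
      rw [Polynomial.aeval_conj, hz0, map_zero]
    rw [aeval_matchingPoly] at h1
    exact (partFun_ne_zero_of_im_pos (by simpa using h) _).1 h1
  · rw [aeval_matchingPoly] at hz0
    exact (partFun_ne_zero_of_im_pos h _).1 hz0

lemma card_roots_matchingPoly : (matchingPoly G).roots.card = Fintype.card V := by
  rw [← (splits_matchingPoly G).natDegree_eq_card_roots, natDegree_matchingPoly]

variable {G} in
lemma abs_le_of_mem_roots {D : ℕ} (hD : DegreeLE G D) {z : ℝ} (hz : z ∈ (matchingPoly G).roots) :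
    |z| ≤ D + 1 := by
  by_contra! h
  have := Polynomial.isRoot_of_mem_roots hz
  rw [Polynomial.IsRoot, eval_matchingPoly] at this
  exact (partFun_ne_zero_of_le_abs hD h.le _).1 this

lemma integral_multiset_sum_dirac (s : Multiset ℝ) (f : ℝ → ℝ) :
    Integrable f (s.map fun z => Measure.dirac z).sum ∧
      ∫ z, f z ∂(s.map fun z => Measure.dirac z).sum = (s.map f).sum := by
  induction s using Multiset.induction with
  | empty => simp
  | cons a s ih =>
    have ha : Integrable f (Measure.dirac a) := integrable_dirac (by simp)
    simp only [Multiset.map_cons, Multiset.sum_cons]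
    exact ⟨ha.add_measure ih.1, by rw [integral_add_measure ha ih.1, ih.2, integral_dirac]⟩

lemma integral_matchingMeasure (f : ℝ → ℝ) : ∫ z, f z ∂(matchingMeasure G) =
    (Fintype.card V : ℝ)⁻¹ * ((matchingPoly G).roots.map f).sum := by
  rw [matchingMeasure, integral_smul_measure, (integral_multiset_sum_dirac _ f).2]
  simp

lemma isProbabilityMeasure_matchingMeasure [Nonempty V] :
    IsProbabilityMeasure (matchingMeasure G) := by
  have h : ∀ s : Multiset ℝ, (s.map fun z => Measure.dirac z).sum Set.univ = s.card := by
    intro s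
    induction s using Multiset.induction with
    | empty => simp
    | cons a s ih => simp [ih, add_comm]
  constructor
  rw [matchingMeasure, Measure.smul_apply, h, card_roots_matchingPoly, smul_eq_mul]
  exact ENNReal.inv_mul_cancel (by simp) (by simp)

lemma integral_matchingMeasure_le [Nonempty V] {f g : ℝ → ℝ}
    (h : ∀ z ∈ (matchingPoly G).roots, f z ≤ g z) :
    ∫ z, f z ∂(matchingMeasure G) ≤ ∫ z, g z ∂(matchingMeasure G) := by
  rw [integral_matchingMeasure, integral_matchingMeasure]
  exact mul_le_mul_of_nonneg_left (Multiset.sum_map_le_sum_map _ _ h) (by positivity)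

lemma integrable_matchingMeasure [Nonempty V] (f : ℝ → ℝ) : Integrable f (matchingMeasure G) :=
  (integral_multiset_sum_dirac _ f).1.smul_measure (by simp)

/-- The Stieltjes transform of the matching measure is the average of the deletion ratios. -/
lemma integral_stieltjes {D : ℕ} (hD : DegreeLE G D) {x : ℝ} (hx : (D : ℝ) + 1 ≤ |x|) :
    ∫ z, 1 / (x - z) ∂(matchingMeasure G) =
      (Fintype.card V : ℝ)⁻¹ * ∑ v, delRatio G x Finset.univ v := by
  classical
  rw [integral_matchingMeasure]
  have h0 := (partFun_ne_zero_of_le_abs hD hx Finset.univ).1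
  rw [← (splits_matchingPoly G).eval_derivative_div_eval_of_ne_zero (x := x)
    (by rwa [eval_matchingPoly]), derivative_matchingPoly, eval_matchingPoly,
    Polynomial.eval_finsetSum, Finset.sum_div]
  congr 1
  refine Finset.sum_congr rfl fun v _ => ?_
  rw [delRatio, ← Polynomial.coe_evalRingHom, map_partFun]
  simp

end Roots

/-! ### The Stieltjes transform is a local quantity -/

section Locality

open Classical in
/-- The recursion for `delRatio` broken off after `r` steps; it only sees the `r`-ball. -/
noncomputable def truncRatio {V : Type u} (G : SimpleGraph V) (x : ℝ) : ℕ → Finset V → V → ℝ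
  | 0, _, _ => 0
  | r + 1, S, v => 1 / (x - ∑ u ∈ nbrsIn G (S.erase v) v, truncRatio G x r (S.erase v) u)

/-- For large `x` the recursion contracts, so breaking it off is exponentially harmless. -/
lemma abs_delRatio_sub_truncRatio_le {V : Type u} [Fintype V] {G : SimpleGraph V} {D : ℕ}
    (hD : DegreeLE G D) {x : ℝ} (hx : 2 * (D : ℝ) + 1 ≤ x) (r : ℕ) {S : Finset V} {v : V}
    (hv : v ∈ S) :
    |truncRatio G x r S v| ≤ 1 ∧ |delRatio G x S v - truncRatio G x r S v| ≤ (1 / 2) ^ r := by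
  have hD0 : (0 : ℝ) ≤ D := Nat.cast_nonneg D
  have hx' : (D : ℝ) + 1 ≤ |x| := le_trans (by linarith) (le_abs_self x)
  induction r generalizing S v with
  | zero => simpa [truncRatio] using (partFun_ne_zero_of_le_abs hD hx' S).2 v hv
  | succ r ih =>
    classical
    have hmem : ∀ u ∈ nbrsIn G (S.erase v) v, u ∈ S.erase v := fun u hu => (mem_nbrsIn.1 hu).1
    have ha := hD.abs_sum_le (S.erase v) v (f := delRatio G x (S.erase v)) zero_le_one
      fun u hu => (partFun_ne_zero_of_le_abs hD hx' _).2 u (hmem u hu)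
    have hb := hD.abs_sum_le (S.erase v) v (f := truncRatio G x r (S.erase v)) zero_le_one
      fun u hu => (ih (hmem u hu)).1
    have hab := hD.abs_sum_le (S.erase v) v
      (f := fun u => delRatio G x (S.erase v) u - truncRatio G x r (S.erase v) u)
      (by positivity) fun u hu => (ih (hmem u hu)).2
    rw [delRatio_eq hD hx' hv, truncRatio]
    rw [Finset.sum_sub_distrib] at hab
    set a := ∑ u ∈ nbrsIn G (S.erase v) v, delRatio G x (S.erase v) u
    set b := ∑ u ∈ nbrsIn G (S.erase v) v, truncRatio G x r (S.erase v) u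
    have ha1 : (D : ℝ) + 1 ≤ x - a := by linarith [(abs_le.1 ha).2]
    have hb1 : (D : ℝ) + 1 ≤ x - b := by linarith [(abs_le.1 hb).2]
    have ha0 : 0 < x - a := by linarith
    have hb0 : 0 < x - b := by linarith
    constructor
    · rw [abs_of_pos (by positivity), div_le_one hb0]
      linarith
    · have : 1 / (x - a) - 1 / (x - b) = (a - b) / ((x - a) * (x - b)) := by
        field_simp
        ring
      rw [this, abs_div, abs_of_pos (mul_pos ha0 hb0), div_le_iff₀ (mul_pos ha0 hb0)]
      have h1 : ((D : ℝ) + 1) * (D + 1) ≤ (x - a) * (x - b) :=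
        mul_le_mul ha1 hb1 (by linarith) ha0.le
      have h2 : (D : ℝ) ≤ 1 / 2 * ((x - a) * (x - b)) := by nlinarith
      calc |a - b| ≤ D * (1 / 2) ^ r := hab
        _ ≤ (1 / 2 * ((x - a) * (x - b))) * (1 / 2) ^ r :=
          mul_le_mul_of_nonneg_right h2 (by positivity)
        _ = (1 / 2) ^ (r + 1) * ((x - a) * (x - b)) := by ring

/-- `truncRatio` is computed inside any induced subgraph containing the `r`-ball. -/
lemma truncRatio_comap {V : Type u} {W : Type v} {G : SimpleGraph V} {H : SimpleGraph W}
    (ι : H ↪g G) (x : ℝ) (r : ℕ) {S : Finset V} {S' : Finset W} (hS : ∀ w, w ∈ S' ↔ ι w ∈ S)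
    {w : W} (hw : ∀ y, G.edist (ι w) y ≤ r → y ∈ Set.range ι) :
    truncRatio G x r S (ι w) = truncRatio H x r S' w := by
  classical
  induction r generalizing S S' w with
  | zero => rfl
  | succ r ih =>
    have hS' : ∀ w', w' ∈ S'.erase w ↔ ι w' ∈ S.erase (ι w) := by
      intro w'
      simp [hS]
    have hnb : nbrsIn G (S.erase (ι w)) (ι w) =
        (nbrsIn H (S'.erase w) w).map ι.toEmbedding := by
      ext y
      simp only [mem_nbrsIn, Finset.mem_map, RelEmbedding.coe_toEmbedding]
      constructor
      · rintro ⟨hy, hadj⟩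
        obtain ⟨w', rfl⟩ := hw y ((SimpleGraph.edist_le hadj.toWalk).trans (by simp))
        exact ⟨w', ⟨(hS' w').2 hy, ι.map_adj_iff.1 hadj⟩, rfl⟩
      · rintro ⟨w', ⟨h1, h2⟩, rfl⟩
        exact ⟨(hS' w').1 h1, ι.map_adj_iff.2 h2⟩
    rw [truncRatio, truncRatio, hnb, Finset.sum_map]
    congr 2
    refine Finset.sum_congr rfl fun w' hw' => ih hS' fun y hy => hw y ?_
    have hadj : G.Adj (ι w) (ι w') := ι.map_adj_iff.2 (mem_nbrsIn.1 hw').2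
    refine SimpleGraph.edist_triangle.trans
      ((add_le_add (SimpleGraph.edist_le hadj.toWalk) hy).trans ?_)
    simp [add_comm]

lemma truncRatio_eq_of_ballIso {V : Type u} [Fintype V] {W : Type v} [Fintype W]
    {G : SimpleGraph V} {A : SimpleGraph W} {o : V} {a : W} {r : ℕ} (h : BallIso G o r A a)
    (x : ℝ) : truncRatio G x r Finset.univ o = truncRatio A x r Finset.univ a := by
  obtain ⟨φ, hφ⟩ := h
  have ho : o ∈ closedBall G o r := by simp [closedBall]
  have ha : φ.symm a = ⟨o, ho⟩ := by
    rw [← hφ ⟨o, ho⟩ rfl, RelIso.symm_apply_apply]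
  let ι : A ↪g G := φ.symm.toRelEmbedding.trans (SimpleGraph.Embedding.induce _)
  have hιa : ι a = o := by
    change ((φ.symm a : closedBall G o r) : V) = o
    rw [ha]
  have := truncRatio_comap ι x r (S := Finset.univ) (S' := Finset.univ) (by simp) (w := a) ?_
  · rwa [hιa] at this
  · intro y hy
    rw [hιa] at hy
    refine ⟨φ ⟨y, hy⟩, ?_⟩
    change ((φ.symm (φ ⟨y, hy⟩) : closedBall G o r) : V) = y
    simp

/-- The vertices with the right ball contribute the exponentially small error of the truncation, the
others an error of at most `2`. -/
lemma abs_stieltjes_sub_truncRatio_le {V : Type u} [Fintype V] [Nonempty V] {W : Type v}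
    [Fintype W] {G : SimpleGraph V} {A : SimpleGraph W} {a : W} {D : ℕ} (hD : DegreeLE G D) {x : ℝ}
    (hx : 2 * (D : ℝ) + 1 ≤ x) (r : ℕ) (hA : |truncRatio A x r Finset.univ a| ≤ 1) :
    |∫ z, 1 / (x - z) ∂(matchingMeasure G) - truncRatio A x r Finset.univ a| ≤
      (1 / 2) ^ r + 2 * (1 - ballProb G r A a) := by
  classical
  have hD0 : (0 : ℝ) ≤ D := Nat.cast_nonneg D
  have hx' : (D : ℝ) + 1 ≤ |x| := le_trans (by linarith) (le_abs_self x)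
  have hn : (0 : ℝ) < Fintype.card V := Nat.cast_pos.2 Fintype.card_pos
  set t := truncRatio A x r Finset.univ a
  set s := Finset.univ.filter fun o => BallIso G o r A a
  have hs : ballProb G r A a = s.card / Fintype.card V := by
    rw [ballProb]
    congr 2
    rw [← Set.ncard_coe_finset]
    congr 1
    ext o; simp [s]
  have hpt : ∀ v, |delRatio G x Finset.univ v - t| ≤
      (1 / 2) ^ r + 2 * (1 - if v ∈ s then 1 else 0) := by
    intro v
    have h := abs_delRatio_sub_truncRatio_le hD hx r (Finset.mem_univ v)
    split_ifs with hv
    · simp only [s, Finset.mem_filter, Finset.mem_univ, true_and] at hv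
      rw [truncRatio_eq_of_ballIso hv x] at h
      simpa using h.2
    · have h1 := (partFun_ne_zero_of_le_abs hD hx' Finset.univ).2 v (Finset.mem_univ v)
      have h2 := abs_sub (delRatio G x Finset.univ v) t
      have : (0 : ℝ) ≤ (1 / 2) ^ r := by positivity
      linarith
  have hint : ∫ z, 1 / (x - z) ∂(matchingMeasure G) - t =
      (Fintype.card V : ℝ)⁻¹ * ∑ v, (delRatio G x Finset.univ v - t) := by
    rw [integral_stieltjes G hD hx', Finset.sum_sub_distrib, mul_sub]
    simp [hn.ne']
  rw [hint, abs_mul, abs_of_pos (inv_pos.2 hn), inv_mul_le_iff₀ hn]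
  refine (Finset.abs_sum_le_sum_abs _ _).trans ((Finset.sum_le_sum fun v _ => hpt v).trans ?_)
  rw [hs, Finset.sum_add_distrib, ← Finset.mul_sum, Finset.sum_sub_distrib, Finset.sum_ite_mem]
  simp
  apply le_of_eq
  field_simp

lemma degreeLE_of_ncard_le {V : Type u} [Fintype V] {G : SimpleGraph V} {D : ℕ}
    (h : ∀ x : V, (G.neighborSet x).ncard ≤ D) : DegreeLE G D := by
  intro v
  rw [← Set.ncard_coe_finset]
  convert h v
  ext u; simp

/-- The Stieltjes transforms of the matching measures along two sequences with the same
Benjamini-Schramm limit approach each other. -/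
lemma tendsto_stieltjes_sub {W : Type w} {T : SimpleGraph W} {o : W}
    (hball : ∀ r : ℕ, ∃ (n : ℕ) (A : SimpleGraph (Fin n)) (a : Fin n), BallIso T o r A a)
    {V V' : ℕ → Type} [∀ i, Fintype (V i)] [∀ i, Nonempty (V i)]
    [∀ i, Fintype (V' i)] [∀ i, Nonempty (V' i)]
    {G : ∀ i, SimpleGraph (V i)} {G' : ∀ i, SimpleGraph (V' i)}
    (hG : BSConverges G T o) (hG' : BSConverges G' T o) {D : ℕ} (hD : ∀ i, DegreeLE (G i) D)
    (hD' : ∀ i, DegreeLE (G' i) D) {x : ℝ} (hx : 2 * (D : ℝ) + 1 ≤ x) :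
    Tendsto (fun i => ∫ z, 1 / (x - z) ∂(matchingMeasure (G i)) -
      ∫ z, 1 / (x - z) ∂(matchingMeasure (G' i))) atTop (𝓝 0) := by
  classical
  rw [Metric.tendsto_atTop']
  intro ε hε
  obtain ⟨r, hr⟩ := exists_pow_lt_of_lt_one (show 0 < ε / 4 by linarith)
    (show (1 / 2 : ℝ) < 1 by norm_num)
  have hr1 : (1 / 2 : ℝ) ^ (r + 1) < ε / 4 :=
    (pow_le_pow_of_le_one (by norm_num) (by norm_num) (Nat.le_succ r)).trans_lt hr
  obtain ⟨n, A, a, hA⟩ := hball (r + 1)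
  have key : ∀ {U : ℕ → Type} [∀ i, Fintype (U i)] [∀ i, Nonempty (U i)]
      {K : ∀ i, SimpleGraph (U i)}, BSConverges K T o → (∀ i, DegreeLE (K i) D) →
      ∀ᶠ i in atTop, |∫ z, 1 / (x - z) ∂(matchingMeasure (K i)) -
        truncRatio A x (r + 1) Finset.univ a| < ε / 2 := by
    intro U _ _ K hK hDK
    have h1 := hK.2 (r + 1) (Nat.succ_pos r) n A a
    rw [if_pos hA] at h1
    have hpos : ∀ᶠ i in atTop, 1 - min 1 (ε / 8) < ballProb (K i) (r + 1) A a :=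
      h1.eventually (lt_mem_nhds (by
        have : 0 < min 1 (ε / 8) := lt_min one_pos (by linarith)
        linarith))
    filter_upwards [hpos] with i hi
    -- A vertex with the right ball exists, so the truncated ratio of `A` is a ratio in `K i`.
    have hne : (0 : ℝ) < ballProb (K i) (r + 1) A a := by
      linarith [min_le_left 1 (ε / 8)]
    have hex : ∃ v, BallIso (K i) v (r + 1) A a := by
      by_contra! hno
      simp [ballProb, hno] at hne
    obtain ⟨v, hv⟩ := hex
    have hA1 : |truncRatio A x (r + 1) Finset.univ a| ≤ 1 := by
      rw [← truncRatio_eq_of_ballIso hv x]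
      exact (abs_delRatio_sub_truncRatio_le (hDK i) hx (r + 1) (Finset.mem_univ v)).1
    have := abs_stieltjes_sub_truncRatio_le (hDK i) hx (r + 1) hA1
    linarith [min_le_right 1 (ε / 8)]
  obtain ⟨N, hN⟩ := eventually_atTop.1 ((key hG hD).and (key hG' hD'))
  refine ⟨N, fun i hi => ?_⟩
  obtain ⟨h1, h2⟩ := hN i hi.le
  rw [Real.dist_eq, sub_zero]
  rw [abs_lt] at h1 h2 ⊢
  constructor <;> linarith

end Locality

/-! ### From Stieltjes transforms to weak limits -/

section LimitMeasure

lemma abs_integral_matchingMeasure_sub_le {V : Type u} [Fintype V] [Nonempty V]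
    {G : SimpleGraph V} {D : ℕ} (hD : DegreeLE G D) {f g : ℝ → ℝ} {ε : ℝ}
    (h : ∀ z, |z| ≤ (D : ℝ) + 1 → |f z - g z| ≤ ε) :
    |∫ z, f z ∂(matchingMeasure G) - ∫ z, g z ∂(matchingMeasure G)| ≤ ε := by
  have := isProbabilityMeasure_matchingMeasure G
  have hroots : ∀ z ∈ (matchingPoly G).roots, |f z - g z| ≤ ε :=
    fun z hz => h z (abs_le_of_mem_roots hD hz)
  rw [← integral_sub (integrable_matchingMeasure G f) (integrable_matchingMeasure G g), abs_le]
  have h1 := integral_matchingMeasure_le G (f := fun _ => -ε) (g := fun z => f z - g z)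
    fun z hz => (abs_le.1 (hroots z hz)).1
  have h2 := integral_matchingMeasure_le G (g := fun _ => ε) (f := fun z => f z - g z)
    fun z hz => (abs_le.1 (hroots z hz)).2
  simp only [integral_const, probReal_univ, one_smul] at h1 h2
  exact ⟨h1, h2⟩

section TwoSequences

variable {V V' : ℕ → Type} [∀ i, Fintype (V i)] [∀ i, Fintype (V' i)]
  {G : ∀ i, SimpleGraph (V i)} {G' : ∀ i, SimpleGraph (V' i)} {D : ℕ}

variable (G G') in
/-- The integrals of `f` against the matching measures of the two sequences approach each other. -/
def AgreesOn (f : ℝ → ℝ) : Prop :=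
  Tendsto (fun i => ∫ z, f z ∂(matchingMeasure (G i)) - ∫ z, f z ∂(matchingMeasure (G' i)))
    atTop (𝓝 0)

lemma AgreesOn.const_mul {f : ℝ → ℝ} (hf : AgreesOn G G' f) (c : ℝ) :
    AgreesOn G G' fun z => c * f z := by
  have := Tendsto.const_mul c hf
  rw [mul_zero] at this
  refine this.congr fun i => ?_
  rw [integral_const_mul, integral_const_mul]
  ring

variable [∀ i, Nonempty (V i)] [∀ i, Nonempty (V' i)]

lemma AgreesOn.add {f g : ℝ → ℝ} (hf : AgreesOn G G' f) (hg : AgreesOn G G' g) :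
    AgreesOn G G' fun z => f z + g z := by
  have := Tendsto.add hf hg
  rw [add_zero] at this
  refine this.congr fun i => ?_
  rw [integral_add (integrable_matchingMeasure _ _) (integrable_matchingMeasure _ _),
    integral_add (integrable_matchingMeasure _ _) (integrable_matchingMeasure _ _)]
  ring

lemma AgreesOn.sum {ι : Type*} (s : Finset ι) {f : ι → ℝ → ℝ}
    (hf : ∀ j ∈ s, AgreesOn G G' (f j)) : AgreesOn G G' fun z => ∑ j ∈ s, f j z := by
  classical
  induction s using Finset.induction_on with
  | empty => simp [AgreesOn]
  | insert a s ha ih =>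
    simp_rw [Finset.sum_insert ha]
    exact (hf a (by simp)).add (ih fun j hj => hf j (by simp [hj]))

lemma AgreesOn.of_approx (hD : ∀ i, DegreeLE (G i) D) (hD' : ∀ i, DegreeLE (G' i) D) {f : ℝ → ℝ}
    (h : ∀ ε > 0, ∃ g, AgreesOn G G' g ∧ ∀ z, |z| ≤ (D : ℝ) + 1 → |f z - g z| ≤ ε) :
    AgreesOn G G' f := by
  rw [AgreesOn, Metric.tendsto_atTop']
  intro ε hε
  obtain ⟨g, hg, hfg⟩ := h (ε / 4) (by linarith)
  obtain ⟨N, hN⟩ := (Metric.tendsto_atTop'.1 hg) (ε / 4) (by linarith)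
  refine ⟨N, fun i hi => ?_⟩
  have h1 := hN i hi
  have h2 := abs_integral_matchingMeasure_sub_le (hD i) hfg
  have h3 := abs_integral_matchingMeasure_sub_le (hD' i) hfg
  rw [Real.dist_eq, sub_zero] at h1 ⊢
  rw [abs_lt] at h1 ⊢
  rw [abs_le] at h2 h3
  constructor <;> linarith

/-- Agreement of the Stieltjes transforms near infinity gives agreement of all moments, since
`z ^ k` is the limit of `x ^ (k + 1) / (x - z) - ∑ j < k, x ^ (k - j) z ^ j` as `x → ∞`. -/
lemma AgreesOn.pow (hD : ∀ i, DegreeLE (G i) D) (hD' : ∀ i, DegreeLE (G' i) D)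
    (hst : ∀ x : ℝ, 2 * (D : ℝ) + 1 ≤ x → AgreesOn G G' fun z => 1 / (x - z)) (k : ℕ) :
    AgreesOn G G' fun z => z ^ k := by
  induction k using Nat.strong_induction_on with
  | _ k ih =>
    refine AgreesOn.of_approx hD hD' fun ε hε => ?_
    have hD0 : (0 : ℝ) ≤ D := Nat.cast_nonneg D
    -- For this `x` the remainder `z ^ (k + 1) / (x - z)` is at most `ε` when `|z| ≤ D + 1`.
    obtain ⟨x, hx1, hx2⟩ : ∃ x : ℝ, 2 * (D : ℝ) + 2 ≤ x ∧
        ((D : ℝ) + 1) ^ (k + 1) ≤ ε * (x - (D + 1)) := by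
      refine ⟨2 * D + 2 + ((D : ℝ) + 1) ^ (k + 1) / ε,
        le_add_of_nonneg_right (by positivity), ?_⟩
      have : ε * (2 * D + 2 + ((D : ℝ) + 1) ^ (k + 1) / ε - (D + 1)) =
          ε * (D + 1) + ((D : ℝ) + 1) ^ (k + 1) := by
        field_simp
        ring
      rw [this]
      exact le_add_of_nonneg_left (by positivity)
    refine ⟨fun z => x ^ (k + 1) * (1 / (x - z)) +
      ∑ j ∈ Finset.range k, (-x ^ (k - j)) * z ^ j,
      ((hst x (by linarith)).const_mul _).add
        (AgreesOn.sum _ fun j hj => (ih j (Finset.mem_range.1 hj)).const_mul _), fun z hz => ?_⟩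
    have hxz : 0 < x - z := by linarith [(abs_le.1 hz).2]
    have hg := geom_sum₂_mul z x (k + 1)
    rw [Finset.sum_range_succ] at hg
    simp only [Nat.add_sub_cancel, Nat.sub_self, pow_zero, mul_one] at hg
    have hs : ∑ j ∈ Finset.range k, (-x ^ (k - j)) * z ^ j =
        - ∑ j ∈ Finset.range k, z ^ j * x ^ (k - j) := by
      rw [← Finset.sum_neg_distrib]
      exact Finset.sum_congr rfl fun j _ => by ring
    have key : z ^ k - (x ^ (k + 1) * (1 / (x - z)) +
        ∑ j ∈ Finset.range k, (-x ^ (k - j)) * z ^ j) = - (z ^ (k + 1) / (x - z)) := by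
      rw [hs]
      field_simp
      linear_combination -hg
    rw [key, abs_neg, abs_div, abs_of_pos hxz, abs_pow, div_le_iff₀ hxz]
    calc |z| ^ (k + 1) ≤ ((D : ℝ) + 1) ^ (k + 1) := pow_le_pow_left₀ (abs_nonneg z) hz _
      _ ≤ ε * (x - (D + 1)) := hx2
      _ ≤ ε * (x - z) := mul_le_mul_of_nonneg_left (by linarith [(abs_le.1 hz).2]) hε.le

lemma AgreesOn.of_continuous (hD : ∀ i, DegreeLE (G i) D) (hD' : ∀ i, DegreeLE (G' i) D)
    (hst : ∀ x : ℝ, 2 * (D : ℝ) + 1 ≤ x → AgreesOn G G' fun z => 1 / (x - z)) {f : ℝ → ℝ}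
    (hf : Continuous f) : AgreesOn G G' f := by
  refine AgreesOn.of_approx hD hD' fun ε hε => ?_
  obtain ⟨p, hp⟩ := exists_polynomial_near_of_continuousOn (-(D + 1 : ℝ)) (D + 1) f
    hf.continuousOn ε hε
  refine ⟨fun z => p.eval z, ?_, fun z hz => ?_⟩
  · simp_rw [Polynomial.eval_eq_sum_range]
    exact AgreesOn.sum _ fun j _ => (AgreesOn.pow hD hD' hst j).const_mul _
  · rw [abs_sub_comm]
    exact (hp z (abs_le.1 hz)).le

end TwoSequences

/-- The integrals of a continuous function against the matching measures along two sequences with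
the same Benjamini-Schramm limit approach each other. -/
lemma agreesOn_of_bsConverges {W : Type w} {T : SimpleGraph W} {o : W}
    (hball : ∀ r : ℕ, ∃ (n : ℕ) (A : SimpleGraph (Fin n)) (a : Fin n), BallIso T o r A a)
    {V V' : ℕ → Type} [∀ i, Fintype (V i)] [∀ i, Nonempty (V i)]
    [∀ i, Fintype (V' i)] [∀ i, Nonempty (V' i)]
    {G : ∀ i, SimpleGraph (V i)} {G' : ∀ i, SimpleGraph (V' i)}
    (hG : BSConverges G T o) (hG' : BSConverges G' T o) {f : ℝ → ℝ} (hf : Continuous f) :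
    AgreesOn G G' f := by
  obtain ⟨D, hD⟩ := hG.1
  obtain ⟨D', hD'⟩ := hG'.1
  have h1 : ∀ i, DegreeLE (G i) (max D D') :=
    fun i => degreeLE_of_ncard_le fun x => (hD i x).trans (le_max_left _ _)
  have h2 : ∀ i, DegreeLE (G' i) (max D D') :=
    fun i => degreeLE_of_ncard_le fun x => (hD' i x).trans (le_max_right _ _)
  exact AgreesOn.of_continuous h1 h2
    (fun x hx => tendsto_stieltjes_sub hball hG hG' h1 h2 hx) hf

lemma matchingMeasure_compl_Icc {V : Type u} [Fintype V] {G : SimpleGraph V} {D : ℕ}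
    (hD : DegreeLE G D) : matchingMeasure G (Set.Icc (-(D + 1 : ℝ)) (D + 1))ᶜ = 0 := by
  have h : ∀ s : Multiset ℝ, (∀ z ∈ s, |z| ≤ (D : ℝ) + 1) →
      (s.map fun z => Measure.dirac z).sum (Set.Icc (-(D + 1 : ℝ)) (D + 1))ᶜ = 0 := by
    intro s
    induction s using Multiset.induction with
    | empty => simp
    | cons a s ih =>
      intro hs
      simp only [Multiset.map_cons, Multiset.sum_cons, Measure.add_apply]
      rw [ih fun z hz => hs z (by simp [hz]), add_zero,
        Measure.dirac_apply' _ measurableSet_Icc.compl]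
      exact Set.indicator_of_notMem (by simpa using abs_le.1 (hs a (by simp))) _
  rw [matchingMeasure, Measure.smul_apply, h _ fun z hz => abs_le_of_mem_roots hD hz, smul_zero]

lemma exists_subseq_tendsto {V : ℕ → Type} [∀ i, Fintype (V i)] [∀ i, Nonempty (V i)]
    {G : ∀ i, SimpleGraph (V i)} {D : ℕ} (hD : ∀ i, DegreeLE (G i) D) :
    ∃ (ρ : Measure ℝ) (φ : ℕ → ℕ), IsProbabilityMeasure ρ ∧ StrictMono φ ∧ ∀ f : ℝ →ᵇ ℝ,
      Tendsto (fun i => ∫ z, f z ∂(matchingMeasure (G (φ i)))) atTop (𝓝 (∫ z, f z ∂ρ)) := by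
  let P : ℕ → ProbabilityMeasure ℝ := fun i =>
    ⟨matchingMeasure (G i), isProbabilityMeasure_matchingMeasure (G i)⟩
  have htight : IsTightMeasureSet {((μ : ProbabilityMeasure ℝ) : Measure ℝ) | μ ∈ Set.range P} := by
    rw [isTightMeasureSet_iff_exists_isCompact_measure_compl_le]
    intro ε _
    refine ⟨Set.Icc (-(D + 1 : ℝ)) (D + 1), isCompact_Icc, ?_⟩
    rintro _ ⟨_, ⟨i, rfl⟩, rfl⟩
    exact (matchingMeasure_compl_Icc (hD i)).trans_le zero_le
  obtain ⟨ρ, -, φ, hφ, hlim⟩ := (isCompact_closure_of_isTightMeasureSet htight).tendsto_subseq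
    fun i => subset_closure (Set.mem_range_self i)
  exact ⟨ρ, φ, inferInstance, hφ,
    fun f => (ProbabilityMeasure.tendsto_iff_forall_integral_tendsto.1 hlim) f⟩

/-- A rooted graph with finite balls that is a Benjamini-Schramm limit has a unique matching
measure. -/
lemma existsUnique_isLimitMatchingMeasure {W : Type w} {T : SimpleGraph W} {o : W}
    (hball : ∀ r : ℕ, ∃ (n : ℕ) (A : SimpleGraph (Fin n)) (a : Fin n), BallIso T o r A a)
    {V : ℕ → Type} [∀ i, Fintype (V i)] [∀ i, Nonempty (V i)]
    {G : ∀ i, SimpleGraph (V i)} (hG : BSConverges G T o) :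
    ∃! ρ : Measure ℝ, IsLimitMatchingMeasure T o ρ := by
  obtain ⟨D, hD⟩ := hG.1
  obtain ⟨ρ, φ, hρ, hφ, hlim⟩ :=
    exists_subseq_tendsto (G := G) fun i => degreeLE_of_ncard_le (hD i)
  have hGφ : BSConverges (fun i => G (φ i)) T o :=
    ⟨⟨D, fun i => hD (φ i)⟩, fun r hr n A a => (hG.2 r hr n A a).comp hφ.tendsto_atTop⟩
  refine ⟨ρ, ⟨hρ, fun V' _ _ G' hG' f => ?_⟩, ?_⟩
  · have h := Tendsto.add (agreesOn_of_bsConverges hball hG' hGφ f.continuous) (hlim f)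
    simpa using h
  · rintro ρ' ⟨hρ', h⟩
    have := hρ
    exact ext_of_forall_integral_eq_of_IsFiniteMeasure fun f =>
      tendsto_nhds_unique (h _ _ hGφ f) (hlim f)

/-- An upper bound on the normalized matching energies along a sequence passes to the limit,
although `|z|` is unbounded: truncate and use monotone convergence. -/
lemma IsLimitMatchingMeasure.integral_abs_le {W : Type w} {T : SimpleGraph W} {o : W}
    {ρ : Measure ℝ} (hρ : IsLimitMatchingMeasure T o ρ)
    {V : ℕ → Type} [∀ i, Fintype (V i)] [∀ i, Nonempty (V i)]
    {G : ∀ i, SimpleGraph (V i)} (hG : BSConverges G T o) {c : ℝ}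
    (hc : ∀ i, ∫ z, |z| ∂(matchingMeasure (G i)) ≤ c) :
    Integrable (fun z : ℝ => |z|) ρ ∧ ∫ z, |z| ∂ρ ≤ c := by
  have hprob := hρ.1
  let f : ℕ → ℝ → ℝ := fun k z => min |z| k
  have hf0 : ∀ k z, 0 ≤ f k z := fun k z => le_min (abs_nonneg z) (Nat.cast_nonneg k)
  have hfc : ∀ k, Continuous (f k) := fun k => continuous_abs.min continuous_const
  have hfk : ∀ k z, ‖f k z‖ ≤ k := fun k z => by
    rw [Real.norm_of_nonneg (hf0 k z)]
    exact min_le_right _ _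
  have hfint : ∀ k, Integrable (f k) ρ := fun k =>
    (integrable_const (k : ℝ)).mono' (hfc k).aestronglyMeasurable (ae_of_all _ (hfk k))
  have hbound : ∀ k, ∫ z, f k z ∂ρ ≤ c := by
    intro k
    have h := hρ.2 V G hG (BoundedContinuousFunction.ofNormedAddCommGroup (f k) (hfc k) k (hfk k))
    refine le_of_tendsto' h fun i => le_trans ?_ (hc i)
    exact integral_matchingMeasure_le (G i) fun z _ => min_le_left _ _
  have hc0 : 0 ≤ c := (integral_nonneg (hf0 0)).trans (hbound 0)
  have hl : ∫⁻ z, ENNReal.ofReal |z| ∂ρ ≤ ENNReal.ofReal c := by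
    have hmono : ∀ᵐ z ∂ρ, Monotone fun k => ENNReal.ofReal (f k z) := ae_of_all _ fun z k l hkl =>
      ENNReal.ofReal_le_ofReal (min_le_min le_rfl (Nat.cast_le.2 hkl))
    have hlim : ∀ᵐ z ∂ρ, Tendsto (fun k => ENNReal.ofReal (f k z)) atTop
        (𝓝 (ENNReal.ofReal |z|)) := ae_of_all _ fun z => by
      obtain ⟨N, hN⟩ := exists_nat_ge |z|
      refine tendsto_const_nhds.congr' ?_
      filter_upwards [eventually_ge_atTop N] with k hk
      rw [show f k z = |z| from min_eq_left (hN.trans (Nat.cast_le.2 hk))]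
    refine le_of_tendsto' (lintegral_tendsto_of_tendsto_of_monotone
      (fun k => (hfc k).measurable.ennreal_ofReal.aemeasurable) hmono hlim) fun k => ?_
    rw [← ofReal_integral_eq_lintegral_ofReal (hfint k) (ae_of_all _ (hf0 k))]
    exact ENNReal.ofReal_le_ofReal (hbound k)
  constructor
  · refine ⟨continuous_abs.aestronglyMeasurable, ?_⟩
    rw [hasFiniteIntegral_iff_norm]
    simp only [Real.norm_eq_abs, abs_abs]
    exact hl.trans_lt ENNReal.ofReal_lt_top
  · rw [integral_eq_lintegral_of_nonneg_ae (ae_of_all _ abs_nonneg)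
      continuous_abs.aestronglyMeasurable]
    exact ENNReal.toReal_le_of_le_ofReal hc0 hl

end LimitMeasure

/-! ### Large girth implies convergence to the regular tree -/

section Covering

/-- `G` has no closed non-backtracking walk (backtracking at the base point being allowed) of
positive length at most `g`; equivalently, the girth of `G` exceeds `g`. -/
def NoShortCycle {V : Type u} (G : SimpleGraph V) (g : ℕ) : Prop :=
  ∀ (x : ℕ → V) (l : ℕ), 0 < l → l ≤ g → (∀ i < l, G.Adj (x i) (x (i + 1))) →
    (∀ i, i + 1 < l → x i ≠ x (i + 2)) → x 0 ≠ x l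

/-- Every vertex of `G` has exactly `d` neighbours. -/
def IsRegular {V : Type u} (G : SimpleGraph V) (d : ℕ) : Prop :=
  ∀ v, Nonempty (Fin d ≃ G.neighborSet v)

variable {V : Type u} {G : SimpleGraph V} {d : ℕ}

open Classical in
/-- The covering map from `𝕋_d` to a `d`-regular graph, in the form of an automaton: the state after
reading a word is a vertex together with a labelling of its neighbours by letters for which the
first letter of the word labels the previous vertex. -/
noncomputable def coverState (e : ∀ v, Fin d ≃ G.neighborSet v) (o : V) :
    List (Fin d) → Σ v, Fin d ≃ G.neighborSet v
  | [] => ⟨o, e o⟩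
  | a :: w =>
    ⟨(coverState e o w).2 a,
      (Equiv.swap a ((e ((coverState e o w).2 a)).symm
        ⟨(coverState e o w).1, ((coverState e o w).2 a).2.symm⟩)).trans
          (e ((coverState e o w).2 a))⟩

lemma coverState_cons_apply (e : ∀ v, Fin d ≃ G.neighborSet v) (o : V) (a : Fin d)
    (w : List (Fin d)) :
    (((coverState e o (a :: w)).2 a : G.neighborSet _) : V) = (coverState e o w).1 := by
  change ((e _ (Equiv.swap a _ a) : G.neighborSet _) : V) = _
  rw [Equiv.swap_apply_left, Equiv.apply_symm_apply]

/-- The covering map from `𝕋_d` to a `d`-regular graph. -/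
noncomputable def cover (e : ∀ v, Fin d ≃ G.neighborSet v) (o : V) (w : ReducedWord d) : V :=
  (coverState e o w.1).1

/-- Near `w`, the covering map is described by the labelling `(coverState e o w).2`: every neighbour
of `w` in the tree is the only one whose image carries a certain letter. -/
lemma exists_letter (e : ∀ v, Fin d ≃ G.neighborSet v) (o : V) {w w' : ReducedWord d}
    (h : (regularTree d).Adj w w') : ∃ b, ((coverState e o w.1).2 b : V) = cover e o w' ∧
      (w'.1 = b :: w.1 ∨ w.1 = b :: w'.1) := by
  rcases h with ⟨b, hb⟩ | ⟨b, hb⟩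
  · exact ⟨b, by rw [cover, hb]; rfl, Or.inl hb⟩
  · exact ⟨b, by rw [cover, hb]; exact coverState_cons_apply e o b w'.1, Or.inr hb⟩

lemma cover_adj (e : ∀ v, Fin d ≃ G.neighborSet v) (o : V) {w w' : ReducedWord d}
    (h : (regularTree d).Adj w w') : G.Adj (cover e o w) (cover e o w') := by
  obtain ⟨b, hb, -⟩ := exists_letter e o h
  rw [← hb]
  exact ((coverState e o w.1).2 b).2

lemma cover_inj_of_adj (e : ∀ v, Fin d ≃ G.neighborSet v) (o : V) {w w₁ w₂ : ReducedWord d}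
    (h₁ : (regularTree d).Adj w w₁) (h₂ : (regularTree d).Adj w w₂)
    (h : cover e o w₁ = cover e o w₂) : w₁ = w₂ := by
  obtain ⟨b, hb, hb'⟩ := exists_letter e o h₁
  obtain ⟨c, hc, hc'⟩ := exists_letter e o h₂
  rw [← hb, ← hc] at h
  obtain rfl := (coverState e o w.1).2.injective (Subtype.ext h)
  have aux : ∀ {w w₁ w₂ : ReducedWord d}, w₁.1 = b :: w.1 → w.1 = b :: w₂.1 → False := by
    intro w w₁ w₂ h1 h2
    have := w₁.2
    rw [h1, h2, List.isChain_cons_cons] at this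
    exact this.1 rfl
  rcases hb' with h1 | h1 <;> rcases hc' with h2 | h2
  · exact Subtype.ext (h1.trans h2.symm)
  · exact (aux h1 h2).elim
  · exact (aux h2 h1).elim
  · exact Subtype.ext (List.cons.inj (h1.symm.trans h2)).2

lemma cover_surj_of_adj (e : ∀ v, Fin d ≃ G.neighborSet v) (o : V) {w : ReducedWord d} {v : V}
    (h : G.Adj (cover e o w) v) : ∃ w', (regularTree d).Adj w w' ∧ cover e o w' = v := by
  obtain ⟨b, hb⟩ : ∃ b, ((coverState e o w.1).2 b : V) = v :=
    ⟨(coverState e o w.1).2.symm ⟨v, h⟩, by simp⟩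
  obtain ⟨w, hw⟩ := w
  by_cases hw' : ∃ w₀, w = b :: w₀
  · obtain ⟨w₀, rfl⟩ := hw'
    refine ⟨⟨w₀, hw.tail⟩, Or.inr ⟨b, rfl⟩, ?_⟩
    rw [← hb]
    exact (coverState_cons_apply e o b w₀).symm
  · refine ⟨⟨b :: w, ?_⟩, Or.inl ⟨b, rfl⟩, hb⟩
    cases w with
    | nil => exact List.isChain_singleton b
    | cons a w₀ => exact List.isChain_cons_cons.2 ⟨fun h => hw' ⟨w₀, by rw [h]⟩, hw⟩

lemma exists_walk_of_walk_cover (e : ∀ v, Fin d ≃ G.neighborSet v) (o : V) {x v : V}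
    (p : G.Walk x v) : ∀ w, cover e o w = x →
      ∃ w', cover e o w' = v ∧ ∃ q : (regularTree d).Walk w w', q.length = p.length := by
  induction p with
  | nil => exact fun w hw => ⟨w, hw, .nil, rfl⟩
  | cons h p ih =>
    rintro w rfl
    obtain ⟨w₁, hadj, hw₁⟩ := cover_surj_of_adj e o h
    obtain ⟨w', hw', q, hq⟩ := ih w₁ hw₁
    exact ⟨w', hw', .cons hadj q, by simp [hq]⟩

lemma length_le_of_walk {w w' : ReducedWord d} (p : (regularTree d).Walk w w') :
    w'.1.length ≤ w.1.length + p.length := by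
  induction p with
  | nil => simp
  | cons h p ih =>
    rw [SimpleGraph.Walk.length_cons]
    rcases h with ⟨a, h⟩ | ⟨a, h⟩ <;>
      · have := congrArg List.length h
        rw [List.length_cons] at this
        omega

lemma exists_walk_root (w : List (Fin d)) (hw : w.IsChain (· ≠ ·)) :
    ∃ p : (regularTree d).Walk ⟨w, hw⟩ (regularTreeRoot d), p.length = w.length := by
  induction w with
  | nil => exact ⟨.nil, rfl⟩
  | cons a w ih =>
    obtain ⟨p, hp⟩ := ih hw.tail
    exact ⟨.cons (Or.inr ⟨a, rfl⟩) p, congrArg (· + 1) hp⟩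

lemma length_le_of_mem_closedBall {r : ℕ} {w : ReducedWord d}
    (h : w ∈ closedBall (regularTree d) (regularTreeRoot d) r) : w.1.length ≤ r := by
  obtain ⟨p, hp⟩ := SimpleGraph.exists_walk_of_edist_ne_top
    (ne_top_of_le_ne_top (ENat.natCast_ne_top r) h)
  have h1 := length_le_of_walk p
  have h2 : p.length ≤ r := by
    have : (p.length : ℕ∞) ≤ r := hp.trans_le h
    exact_mod_cast this
  have h0 : (regularTreeRoot d).1.length = 0 := rfl
  omega

/-- Two words with the same image would give a short non-backtracking closed walk in `G`. -/
lemma cover_injOn {g : ℕ} (hG : NoShortCycle G g) (e : ∀ v, Fin d ≃ G.neighborSet v) (o : V)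
    {w w' : ReducedWord d} (hl : w.1.length + w'.1.length ≤ g)
    (h : cover e o w = cover e o w') : w = w' := by
  classical
  by_contra hne
  obtain ⟨p, hp⟩ := exists_walk_root w.1 w.2
  obtain ⟨p', hp'⟩ := exists_walk_root w'.1 w'.2
  -- A path in the tree does not backtrack, and its image does not either as the cover is locally
  -- injective.
  let q := (p.append p'.reverse).bypass
  have hq : q.IsPath := SimpleGraph.Walk.bypass_isPath _
  have hql : q.length ≤ g := by
    refine (SimpleGraph.Walk.length_bypass_le_length _).trans ?_
    rw [SimpleGraph.Walk.length_append, SimpleGraph.Walk.length_reverse]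
    omega
  have hq0 : 0 < q.length := by
    rw [Nat.pos_iff_ne_zero]
    exact fun h0 => hne (SimpleGraph.Walk.eq_of_length_eq_zero h0)
  refine hG (fun i => cover e o (q.getVert i)) q.length hq0 hql
    (fun i hi => cover_adj e o (q.adj_getVert_succ hi)) (fun i hi hi' => ?_) (by simpa using h)
  have h1 := q.adj_getVert_succ (show i < q.length by omega)
  have h2 := q.adj_getVert_succ hi
  have h3 := hq.getVert_injOn (show i ≤ q.length by omega) (show i + 2 ≤ q.length by omega)
    (cover_inj_of_adj e o h1.symm h2 hi')
  omega

/-- In a `d`-regular graph of girth larger than `2r + 1` every `r`-ball looks like that of `𝕋_d`. -/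
lemma exists_ball_iso {r : ℕ} (hreg : IsRegular G d) (hG : NoShortCycle G (2 * r + 1)) (o : V) :
    ∃ ψ : (regularTree d).induce (closedBall (regularTree d) (regularTreeRoot d) r) ≃g
      G.induce (closedBall G o r),
      ∀ x : closedBall (regularTree d) (regularTreeRoot d) r,
        (x : ReducedWord d) = regularTreeRoot d ↔ (ψ x : V) = o := by
  obtain ⟨e⟩ : Nonempty (∀ v, Fin d ≃ G.neighborSet v) := ⟨fun v => (hreg v).some⟩
  have hroot : cover e o (regularTreeRoot d) = o := rfl
  have hmem : ∀ w ∈ closedBall (regularTree d) (regularTreeRoot d) r,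
      cover e o w ∈ closedBall G o r := by
    intro w hw
    obtain ⟨p, hp⟩ := SimpleGraph.exists_walk_of_edist_ne_top
      (ne_top_of_le_ne_top (ENat.natCast_ne_top r) hw)
    let f : regularTree d →g G := ⟨cover e o, fun h => cover_adj e o h⟩
    have := SimpleGraph.edist_le (p.map f)
    rw [SimpleGraph.Walk.length_map, hp] at this
    exact this.trans hw
  let F : closedBall (regularTree d) (regularTreeRoot d) r → closedBall G o r :=
    fun w => ⟨cover e o w, hmem w w.2⟩
  have hinj : Function.Injective F := by
    intro w w' h
    have h1 := length_le_of_mem_closedBall w.2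
    have h2 := length_le_of_mem_closedBall w'.2
    exact Subtype.ext (cover_injOn hG e o (by omega) (congrArg Subtype.val h))
  have hsurj : Function.Surjective F := by
    rintro ⟨v, hv⟩
    obtain ⟨p, hp⟩ := SimpleGraph.exists_walk_of_edist_ne_top
      (ne_top_of_le_ne_top (ENat.natCast_ne_top r) hv)
    obtain ⟨w, hw, q, hq⟩ := exists_walk_of_walk_cover e o p _ hroot
    refine ⟨⟨w, (SimpleGraph.edist_le q).trans ?_⟩, Subtype.ext hw⟩
    rw [hq, hp]
    exact hv
  refine ⟨⟨Equiv.ofBijective F ⟨hinj, hsurj⟩, fun {w w'} => ⟨fun h => ?_, fun h => ?_⟩⟩, ?_⟩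
  · change G.Adj (cover e o w) (cover e o w') at h
    change (regularTree d).Adj w w'
    obtain ⟨w₁, hadj, hw₁⟩ := cover_surj_of_adj e o h
    have h1 := length_le_of_mem_closedBall w.2
    have h2 := length_le_of_mem_closedBall w'.2
    have h3 := length_le_of_walk hadj.toWalk
    simp only [SimpleGraph.Walk.length_cons, SimpleGraph.Walk.length_nil] at h3
    rwa [← cover_injOn hG e o (by omega) hw₁]
  · exact cover_adj e o h
  · intro w
    change (w : ReducedWord d) = regularTreeRoot d ↔ cover e o w = o
    constructor
    · intro h; rw [h, hroot]
    · intro h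
      have h1 := length_le_of_mem_closedBall w.2
      have : (regularTreeRoot d).1.length = 0 := rfl
      exact cover_injOn hG e o (by omega) (h.trans hroot.symm)

lemma ballIso_iff {r : ℕ} (hreg : IsRegular G d) (hG : NoShortCycle G (2 * r + 1)) (o : V)
    {α : Type v} (A : SimpleGraph α) (a : α) :
    BallIso G o r A a ↔ BallIso (regularTree d) (regularTreeRoot d) r A a := by
  obtain ⟨ψ, hψ⟩ := exists_ball_iso hreg hG o
  constructor
  · rintro ⟨φ, hφ⟩
    exact ⟨ψ.trans φ, fun x hx => hφ _ ((hψ x).1 hx)⟩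
  · rintro ⟨φ, hφ⟩
    exact ⟨ψ.symm.trans φ, fun x hx => hφ _ ((hψ _).2
      ((congrArg Subtype.val (ψ.apply_symm_apply x)).trans hx))⟩

lemma exists_fin_ballIso {r : ℕ} [Finite V] (G : SimpleGraph V) (o : V) :
    ∃ (n : ℕ) (A : SimpleGraph (Fin n)) (a : Fin n), BallIso G o r A a := by
  obtain ⟨n, ⟨f⟩⟩ := Finite.exists_equiv_fin (closedBall G o r)
  have ho : o ∈ closedBall G o r := by simp [closedBall]
  refine ⟨n, (G.induce (closedBall G o r)).map f.toEmbedding, f ⟨o, ho⟩,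
    SimpleGraph.Iso.map f _, fun x hx => ?_⟩
  have : x = ⟨o, ho⟩ := Subtype.ext hx
  rw [this]
  rfl

lemma ncard_neighborSet (hreg : IsRegular G d) (v : V) : (G.neighborSet v).ncard = d := by
  obtain ⟨e⟩ := hreg v
  rw [← Nat.card_coe_set_eq, ← Nat.card_congr e, Nat.card_fin]

/-- Regular graphs whose girth tends to infinity converge to the regular tree. -/
lemma bsConverges_regularTree {V : ℕ → Type} [∀ i, Fintype (V i)] [∀ i, Nonempty (V i)]
    {G : ∀ i, SimpleGraph (V i)} (hreg : ∀ i, IsRegular (G i) d)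
    (hG : ∀ i, NoShortCycle (G i) i) :
    BSConverges G (regularTree d) (regularTreeRoot d) := by
  refine ⟨⟨d, fun i x => (ncard_neighborSet (hreg i) x).le⟩, fun r _ n A a => ?_⟩
  refine tendsto_const_nhds.congr' ?_
  filter_upwards [eventually_ge_atTop (2 * r + 1)] with i hi
  have hGi : NoShortCycle (G i) (2 * r + 1) := fun x l h0 hl => hG i x l h0 (hl.trans hi)
  simp only [ballProb, ballIso_iff (hreg i) hGi]
  split_ifs with h
  · simp [h, Set.ncard_univ]
  · simp [h]

end Covering

/-! ### Covers of larger girth -/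

section Lifts

variable {V : Type u} {ι : Type v}

/-- The lift of `G` with group `(ℤ/2)^ι` and voltages `s`: the `i`-th coordinate is switched along
the edges `e` with `s i e = true`. -/
def signedLift (G : SimpleGraph V) (s : ι → Sym2 V → Bool) : SimpleGraph (V × (ι → Bool)) where
  Adj p q := G.Adj p.1 q.1 ∧ ∀ i, q.2 i = (p.2 i ^^ s i s(p.1, q.1))
  symm := ⟨fun p q h => ⟨h.1.symm, fun i => by rw [h.2 i, Sym2.eq_swap]; simp⟩⟩
  loopless := ⟨fun p h => h.1.ne rfl⟩

lemma IsRegular.signedLift {G : SimpleGraph V} {d : ℕ} (hG : IsRegular G d)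
    (s : ι → Sym2 V → Bool) : IsRegular (signedLift G s) d := by
  rintro ⟨v, x⟩
  obtain ⟨e⟩ := hG v
  refine ⟨e.trans ⟨fun y => ⟨(y, fun i => x i ^^ s i s(v, y)), y.2, fun i => rfl⟩,
    fun q => ⟨q.1.1, q.2.1⟩, fun y => rfl, fun q => Subtype.ext (Prod.ext rfl ?_)⟩⟩
  funext i
  exact (q.2.2 i).symm

open Classical in
/-- Giving every edge its own coordinate increases the girth: along a closed walk of the lift
every edge of `G` is used an even number of times, so the projection returns to its first edge
prematurely. -/
lemma NoShortCycle.signedLift {G : SimpleGraph V} {g : ℕ} (hG : NoShortCycle G g) :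
    NoShortCycle (signedLift G fun e f => decide (e = f)) (g + 1) := by
  intro y l hl hlg hadj hnb h0
  have hnb' : ∀ i, i + 1 < l → (y i).1 ≠ (y (i + 2)).1 := by
    intro i hi h
    refine hnb i hi (Prod.ext h (funext fun e => ?_))
    rw [(hadj (i + 1) hi).2 e, (hadj i (by omega)).2 e, Sym2.eq_swap (a := (y (i + 1)).1),
      show (y (i + 1 + 1)).1 = (y i).1 from h.symm]
    simp
  have hsub : ∀ a b, a < b → b ≤ l → b - a ≤ g → (y a).1 ≠ (y b).1 := by
    intro a b hab hb hg
    have := hG (fun i => (y (a + i)).1) (b - a) (by omega) hg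
      (fun i hi => (hadj (a + i) (by omega)).1) (fun i hi => hnb' (a + i) (by omega))
    simpa [Nat.add_sub_cancel' hab.le] using this
  have key : ∃ j, 0 < j ∧ j < l ∧ s((y 0).1, (y 1).1) = s((y j).1, (y (j + 1)).1) := by
    by_contra! hno
    -- The coordinate of the first edge changes in the first step and never again.
    have hconst : ∀ j, 0 < j → j ≤ l →
        (y j).2 s((y 0).1, (y 1).1) = !(y 0).2 s((y 0).1, (y 1).1) := by
      intro j hj
      induction j, hj using Nat.le_induction with
      | base =>
        intro _
        rw [(hadj 0 hl).2]
        simp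
      | succ j hj ih =>
        intro hjl
        rw [(hadj j (by omega)).2, ih (by omega)]
        simp [hno j hj (by omega)]
    have := hconst l hl le_rfl
    rw [← h0] at this
    simp at this
  obtain ⟨j, hj0, hjl, hj⟩ := key
  rcases Sym2.eq_iff.1 hj with ⟨h1, -⟩ | ⟨h1, h2⟩
  · exact hsub 0 j hj0 hjl.le (by omega) h1
  · rcases Nat.lt_or_ge 1 j with hj1 | hj1
    · exact hsub 1 j hj1 hjl.le (by omega) h2
    · obtain rfl : j = 1 := by omega
      exact hnb' 0 (by omega) h1

end Lifts

/-! ### Matchings in two-fold covers of bipartite graphs -/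

section LiftMatchings

/-- A bipartite multigraph of maximal degree two, with edge set `A` and end point maps `l`, `r`, has
a proper edge colouring with two colours. For the induction, two edges with a common left end point
are removed and their right end points are merged. -/
lemma exists_two_edge_coloring {E L R : Type*} (A : Finset E) (l : E → L) (r : E → R)
    (hl : ∀ e ∈ A, ∀ f ∈ A, ∀ g ∈ A, l e = l f → l f = l g → e = f ∨ f = g ∨ e = g)
    (hr : ∀ e ∈ A, ∀ f ∈ A, ∀ g ∈ A, r e = r f → r f = r g → e = f ∨ f = g ∨ e = g) :
    ∃ c : E → Bool, ∀ e ∈ A, ∀ f ∈ A, e ≠ f → (l e = l f ∨ r e = r f) → c e ≠ c f := by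
  classical
  induction A using Finset.strongInduction generalizing r with
  | _ A ih =>
  rcases A.eq_empty_or_nonempty with rfl | ⟨e, he⟩
  · exact ⟨fun _ => true, by simp⟩
  by_cases hf : ∃ f ∈ A, f ≠ e ∧ l f = l e
  · obtain ⟨f, hf, hfe, hlf⟩ := hf
    have hmem : ∀ g, g ∈ (A.erase e).erase f ↔ g ≠ f ∧ g ≠ e ∧ g ∈ A := by simp
    obtain ⟨c, hc⟩ := ih ((A.erase e).erase f)
      ((Finset.erase_subset _ _).trans_ssubset (Finset.erase_ssubset he))
      (fun g => if r g = r f then r e else r g)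
      (fun g₁ h₁ g₂ h₂ g₃ h₃ => hl g₁ ((hmem _).1 h₁).2.2 g₂ ((hmem _).1 h₂).2.2 g₃
        ((hmem _).1 h₃).2.2)
      (by
        intro g₁ h₁ g₂ h₂ g₃ h₃ h h'
        rw [hmem] at h₁ h₂ h₃
        have := hr e he
        have := hr f hf
        have := hr g₁ h₁.2.2 g₂ h₂.2.2 g₃ h₃.2.2
        grind)
    simp only [hmem] at hc
    -- The colour `x` for `e` and `!x` for `f`: as the ends of `e` and `f` have been merged, the
    -- edges that meet `e` and `f` there have different colours, so the constraints on `x` agree.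
    obtain ⟨x, hx1, hx2⟩ : ∃ x : Bool, (∀ g, g ≠ f ∧ g ≠ e ∧ g ∈ A → r g = r e → c g ≠ x) ∧
        (∀ g, g ≠ f ∧ g ≠ e ∧ g ∈ A → r g = r f → c g = x) := by
      have h1 := hr e he
      have h2 := hr f hf
      by_cases hg : ∃ g, (g ≠ f ∧ g ≠ e ∧ g ∈ A) ∧ r g = r e
      · obtain ⟨g, hgA, hg⟩ := hg
        refine ⟨!c g, fun g' hg' h => ?_, fun g' hg' h => ?_⟩
        · have : g' = g := by grind
          simp [this]
        · have hne : g' ≠ g := by grind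
          have := hc g' hg' g hgA hne (Or.inr (by grind))
          revert this
          cases c g' <;> cases c g <;> simp
      · push Not at hg
        by_cases hg' : ∃ g, (g ≠ f ∧ g ≠ e ∧ g ∈ A) ∧ r g = r f
        · obtain ⟨g, hgA, hg'⟩ := hg'
          refine ⟨c g, fun g' h h' => (hg g' h h').elim, fun g' h h' => ?_⟩
          have : g' = g := by grind
          rw [this]
        · push Not at hg'
          exact ⟨true, fun g' h h' => (hg g' h h').elim, fun g' h h' => (hg' g' h h').elim⟩
    refine ⟨fun g => if g = e then x else if g = f then !x else c g, ?_⟩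
    have hl1 : ∀ g ∈ A, l g = l e → g = e ∨ g = f := by
      intro g hg h
      have := hl g hg e he f hf h hlf.symm
      grind
    intro g₁ h₁ g₂ h₂ hne h
    have := hl1 g₁ h₁
    have := hl1 g₂ h₂
    have := hx1 g₁
    have := hx1 g₂
    have := hx2 g₁
    have := hx2 g₂
    have := hc g₁
    grind
  · push Not at hf
    obtain ⟨c, hc⟩ := ih (A.erase e) (Finset.erase_ssubset he) r
      (fun g₁ h₁ g₂ h₂ g₃ h₃ => hl g₁ (Finset.mem_of_mem_erase h₁) g₂ (Finset.mem_of_mem_erase h₂)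
        g₃ (Finset.mem_of_mem_erase h₃))
      (fun g₁ h₁ g₂ h₂ g₃ h₃ => hr g₁ (Finset.mem_of_mem_erase h₁) g₂ (Finset.mem_of_mem_erase h₂)
        g₃ (Finset.mem_of_mem_erase h₃))
    simp only [Finset.mem_erase] at hc
    obtain ⟨x, hx⟩ : ∃ x : Bool, ∀ g, g ≠ e ∧ g ∈ A → r g = r e → c g ≠ x := by
      have h1 := hr e he
      by_cases hg : ∃ g, (g ≠ e ∧ g ∈ A) ∧ r g = r e
      · obtain ⟨g, hgA, hg⟩ := hg
        refine ⟨!c g, fun g' hg' h => ?_⟩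
        have : g' = g := by grind
        simp [this]
      · push Not at hg
        exact ⟨true, fun g' h h' => (hg g' h h').elim⟩
    refine ⟨fun g => if g = e then x else c g, ?_⟩
    intro g₁ h₁ g₂ h₂ hne h
    have := hf g₁ h₁
    have := hf g₂ h₂
    have := hx g₁
    have := hx g₂
    have := hc g₁
    grind

variable {E : Type u} {V : Type v} (l r : E → V)

/-- Matchings in the two-fold cover with signs `σ` of a bipartite multigraph with edge set `E` and
end point maps `l`, `r`. The edge `(e, a)` of the cover joins `(l e, a)` to `(r e, a + σ e)`. -/
def IsLiftMatching (σ : E → Bool) (N : Finset (E × Bool)) : Prop :=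
  ∀ p ∈ N, ∀ q ∈ N, p ≠ q → (l p.1 = l q.1 → p.2 ≠ q.2) ∧
    (r p.1 = r q.1 → (p.2 ^^ σ p.1) ≠ (q.2 ^^ σ q.1))

variable {l r}

/-- The edges of the base exactly one lift of which is used. -/
def simplyCovered [Fintype E] [DecidableEq E] (N : Finset (E × Bool)) : Finset E :=
  Finset.univ.filter fun e => ¬ ((e, true) ∈ N ↔ (e, false) ∈ N)

/-- Changing the sheet of the lifts of `e` whenever `s e = true`. -/
def sheetShift (s : E → Bool) : E × Bool ≃ E × Bool where
  toFun p := (p.1, p.2 ^^ s p.1)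
  invFun p := (p.1, p.2 ^^ s p.1)
  left_inv p := by simp
  right_inv p := by simp

lemma mem_map_sheetShift (s : E → Bool) (N : Finset (E × Bool)) (p : E × Bool) :
    p ∈ N.map (sheetShift s).toEmbedding ↔ (p.1, p.2 ^^ s p.1) ∈ N := by
  rw [Finset.mem_map_equiv]
  rfl

lemma simplyCovered_map_sheetShift [Fintype E] [DecidableEq E] (s : E → Bool)
    (N : Finset (E × Bool)) :
    simplyCovered (N.map (sheetShift s).toEmbedding) = simplyCovered N := by
  ext e
  simp only [simplyCovered, Finset.mem_filter, Finset.mem_univ, true_and, mem_map_sheetShift]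
  cases s e <;> simp [iff_comm]

/-- `s` carries matchings of the cover with signs `σ` whose simply covered edges are those in `A` to
matchings of the trivial cover. -/
def IsGoodShift (l r : E → V) (σ : E → Bool) (A : Finset E) (s : E → Bool) : Prop :=
  ∀ e ∈ A, ∀ f ∈ A, e ≠ f → (l e = l f → s e = s f) ∧ (r e = r f → (s e ^^ σ e) = (s f ^^ σ f))

/-- If a matching uses both lifts of an edge, these block both lifts of every adjacent edge. So
edges of a matching of the cover whose projections are distinct and meet are simply covered. -/
lemma IsLiftMatching.mem_simplyCovered [Fintype E] [DecidableEq E] {σ : E → Bool}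
    {N : Finset (E × Bool)} (hN : IsLiftMatching l r σ N) {p q : E × Bool} (hp : p ∈ N)
    (hq : q ∈ N) (hpq : p.1 ≠ q.1) (h : l p.1 = l q.1 ∨ r p.1 = r q.1) :
    p.1 ∈ simplyCovered N := by
  obtain ⟨e, a⟩ := p
  obtain ⟨f, b⟩ := q
  simp only [simplyCovered, Finset.mem_filter, Finset.mem_univ, true_and]
  intro hiff
  change e ≠ f at hpq
  have ht : (e, true) ∈ N := by cases a <;> simp_all
  have hf : (e, false) ∈ N := hiff.1 ht
  have h1 := hN _ ht _ hq (fun h => hpq (Prod.mk.inj h).1)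
  have h2 := hN _ hf _ hq (fun h => hpq (Prod.mk.inj h).1)
  rcases h with h | h
  · have hb : ∀ b : Bool, true ≠ b → false ≠ b → False := by decide
    exact hb _ (h1.1 h) (h2.1 h)
  · have hb : ∀ b s t : Bool, (true ^^ s) ≠ (b ^^ t) → (false ^^ s) ≠ (b ^^ t) → False := by decide
    exact hb _ _ _ (h1.2 h) (h2.2 h)

lemma exists_mem_of_mem_simplyCovered [Fintype E] [DecidableEq E] {N : Finset (E × Bool)} {e : E}
    (he : e ∈ simplyCovered N) : ∃ a, (e, a) ∈ N := by
  simp only [simplyCovered, Finset.mem_filter, Finset.mem_univ, true_and] at he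
  by_contra! h
  exact he (by simp [h])

/-- The sheets used by a matching form a solution of an inhomogeneous linear system over `ℤ/2` on
its simply covered edges. A proper 2-edge-colouring is a solution of the system for the trivial
cover; the sum of the two solutions is a good shift. -/
lemma IsLiftMatching.exists_isGoodShift [Fintype E] [DecidableEq E] {σ : E → Bool}
    {N : Finset (E × Bool)} (hN : IsLiftMatching l r σ N) :
    ∃ s, IsGoodShift l r σ (simplyCovered N) s := by
  choose! c₁ hc₁ using fun e (he : e ∈ simplyCovered N) => exists_mem_of_mem_simplyCovered he
  have hsep : ∀ e ∈ simplyCovered N, ∀ f ∈ simplyCovered N, e ≠ f → (l e = l f → c₁ e ≠ c₁ f) ∧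
      (r e = r f → (c₁ e ^^ σ e) ≠ (c₁ f ^^ σ f)) := fun e he f hf hef =>
    hN _ (hc₁ e he) _ (hc₁ f hf) fun h => hef (congrArg Prod.fst h)
  have hthree : ∀ a b c : Bool, a ≠ b → b ≠ c → a ≠ c → False := by decide
  obtain ⟨c₀, hc₀⟩ := exists_two_edge_coloring (simplyCovered N) l r
    (fun e he f hf g hg h1 h2 => by
      by_contra! h
      exact hthree _ _ _ ((hsep e he f hf h.1).1 h1) ((hsep f hf g hg h.2.1).1 h2)
        ((hsep e he g hg h.2.2).1 (h1.trans h2)))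
    (fun e he f hf g hg h1 h2 => by
      by_contra! h
      exact hthree _ _ _ ((hsep e he f hf h.1).2 h1) ((hsep f hf g hg h.2.1).2 h2)
        ((hsep e he g hg h.2.2).2 (h1.trans h2)))
  refine ⟨fun e => c₀ e ^^ c₁ e, fun e he f hf hef => ⟨fun h => ?_, fun h => ?_⟩⟩
  · have hb : ∀ a a' b b' : Bool, a ≠ a' → b ≠ b' → (a ^^ b) = (a' ^^ b') := by decide
    exact hb _ _ _ _ (hc₀ e he f hf hef (Or.inl h)) ((hsep e he f hf hef).1 h)
  · have hb : ∀ a a' b b' c c' : Bool, a ≠ a' → (b ^^ c) ≠ (b' ^^ c') →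
        (a ^^ b ^^ c) = (a' ^^ b' ^^ c') := by decide
    exact hb _ _ _ _ _ _ (hc₀ e he f hf hef (Or.inr h)) ((hsep e he f hf hef).2 h)

lemma IsLiftMatching.map_sheetShift [Fintype E] [DecidableEq E] {σ s : E → Bool}
    {N : Finset (E × Bool)} (hN : IsLiftMatching l r σ N)
    (hs : IsGoodShift l r σ (simplyCovered N) s) :
    IsLiftMatching l r (fun _ => false) (N.map (sheetShift s).toEmbedding) := by
  rintro ⟨e, a⟩ hp ⟨f, b⟩ hq hpq
  rw [mem_map_sheetShift] at hp hq
  simp only [Bool.xor_false] at hp hq ⊢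
  by_cases hef : e = f
  · subst hef
    have : a ≠ b := fun h => hpq (by rw [h])
    exact ⟨fun _ => this, fun _ => this⟩
  · have hne : ((e, a ^^ s e) : E × Bool) ≠ (f, b ^^ s f) := fun h => hef (congrArg Prod.fst h)
    have h := hN _ hp _ hq hne
    refine ⟨fun h' => ?_, fun h' => ?_⟩
    · have he := hN.mem_simplyCovered hp hq hef (Or.inl h')
      have hf := hN.mem_simplyCovered hq hp (Ne.symm hef) (Or.inl h'.symm)
      have hb : ∀ a b s s' : Bool, s = s' → (a ^^ s) ≠ (b ^^ s') → a ≠ b := by decide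
      exact hb _ _ _ _ ((hs e he f hf hef).1 h') (h.1 h')
    · have he := hN.mem_simplyCovered hp hq hef (Or.inr h')
      have hf := hN.mem_simplyCovered hq hp (Ne.symm hef) (Or.inr h'.symm)
      have hb : ∀ a b s s' t t' : Bool, (s ^^ t) = (s' ^^ t') →
          (a ^^ s ^^ t) ≠ (b ^^ s' ^^ t') → a ≠ b := by decide
      exact hb _ _ _ _ _ _ ((hs e he f hf hef).2 h') (h.2 h')

open Classical in
/-- Among all two-fold covers of a bipartite graph the trivial one has the most matchings. -/
lemma sum_isLiftMatching_le [Fintype E] (l r : E → V) (σ : E → Bool) {t : ℝ} (ht : 0 ≤ t) :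
    ∑ N : Finset (E × Bool) with IsLiftMatching l r σ N, t ^ N.card ≤
      ∑ N : Finset (E × Bool) with IsLiftMatching l r (fun _ => false) N, t ^ N.card := by
  let s : Finset E → E → Bool := fun A =>
    if h : ∃ s, IsGoodShift l r σ A s then h.choose else fun _ => false
  have hs : ∀ N, IsLiftMatching l r σ N →
      IsGoodShift l r σ (simplyCovered N) (s (simplyCovered N)) := by
    intro N hN
    have h := hN.exists_isGoodShift
    simp only [s, dif_pos h]
    exact h.choose_spec
  let φ : Finset (E × Bool) → Finset (E × Bool) := fun N =>
    N.map (sheetShift (s (simplyCovered N))).toEmbedding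
  have hφ : Function.Injective φ := by
    intro N N' h
    have h1 : simplyCovered N = simplyCovered N' := by
      rw [← simplyCovered_map_sheetShift (s (simplyCovered N)) N,
        ← simplyCovered_map_sheetShift (s (simplyCovered N')) N']
      exact congrArg simplyCovered h
    simp only [φ, h1] at h
    exact Finset.map_injective _ h
  calc ∑ N : Finset (E × Bool) with IsLiftMatching l r σ N, t ^ N.card
      = ∑ N ∈ (Finset.univ.filter (IsLiftMatching l r σ)).map ⟨φ, hφ⟩, t ^ N.card := by
        rw [Finset.sum_map]
        exact Finset.sum_congr rfl fun N _ => by simp [φ]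
    _ ≤ _ := by
        refine Finset.sum_le_sum_of_subset_of_nonneg ?_ fun _ _ _ => by positivity
        intro N hN
        simp only [Finset.mem_map, Finset.mem_filter, Finset.mem_univ, true_and,
          Function.Embedding.coeFn_mk] at hN ⊢
        obtain ⟨N, hN, rfl⟩ := hN
        exact hN.map_sheetShift (hs N hN)

open Classical in
/-- The matching generating function in terms of an enumeration of the edges. -/
lemma partFun_one_eq_sum {W : Type v} [Fintype W] {H : SimpleGraph W} {X : Type u} [Fintype X]
    (ψ : X ↪ Sym2 W) (hψ : Set.range ψ = H.edgeSet) (t : ℝ) :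
    partFun H 1 t Finset.univ =
      ∑ N : Finset X with (∀ p ∈ N, ∀ q ∈ N, p ≠ q → ∀ x ∈ ψ p, x ∉ ψ q), t ^ N.card := by
  simp only [partFun, one_pow, one_mul]
  symm
  refine Finset.sum_bij (fun N _ => N.map ψ) ?_ (fun N _ N' _ h => Finset.map_injective _ h) ?_
    (fun N _ => by simp)
  · intro N hN
    simp only [Finset.mem_filter, Finset.mem_univ, true_and] at hN
    rw [mem_matchingsIn]
    constructor
    · intro e he
      obtain ⟨p, -, rfl⟩ := Finset.mem_map.1 he
      exact ⟨hψ ▸ Set.mem_range_self p, by simp⟩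
    · intro e he f hf hef
      obtain ⟨p, hp, rfl⟩ := Finset.mem_map.1 he
      obtain ⟨q, hq, rfl⟩ := Finset.mem_map.1 hf
      exact hN p hp q hq fun h => hef (by rw [h])
  · intro M hM
    rw [mem_matchingsIn] at hM
    refine ⟨Finset.univ.filter fun p => ψ p ∈ M, ?_, ?_⟩
    · simp only [Finset.mem_filter, Finset.mem_univ, true_and]
      exact fun p hp q hq hpq => hM.2 _ hp _ hq fun h => hpq (ψ.injective h)
    · ext e
      simp only [Finset.mem_map, Finset.mem_filter, Finset.mem_univ, true_and]
      constructor
      · rintro ⟨p, hp, rfl⟩; exact hp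
      · intro he
        obtain ⟨p, rfl⟩ : e ∈ Set.range ψ := hψ ▸ (hM.1 e he).1
        exact ⟨p, he, rfl⟩

/-- The two-fold cover of `G` with signs `σ`. -/
def twoLift {V : Type u} (G : SimpleGraph V) (σ : Sym2 V → Bool) : SimpleGraph (V × Bool) where
  Adj p q := G.Adj p.1 q.1 ∧ q.2 = (p.2 ^^ σ s(p.1, q.1))
  symm := ⟨fun p q h => ⟨h.1.symm, by rw [h.2, Sym2.eq_swap]; simp⟩⟩
  loopless := ⟨fun p h => h.1.ne rfl⟩

/-- `l` and `r` are the left and right end point maps of the edges of the bipartite graph `G`,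
enumerated by `E`. -/
structure IsEdgeEnum {V : Type u} (G : SimpleGraph V) {E : Type v} (l r : E → V) : Prop where
  left_ne_right : ∀ e f, l e ≠ r f
  ext : ∀ e f, l e = l f → r e = r f → e = f
  adj : ∀ e, G.Adj (l e) (r e)
  exists_eq : ∀ x y, G.Adj x y → ∃ e, (x = l e ∧ y = r e) ∨ (x = r e ∧ y = l e)

section EdgeEnum

variable {V : Type u} {G : SimpleGraph V} {E : Type u} {l r : E → V}

/-- The edges of `G`. -/
def IsEdgeEnum.edge (h : IsEdgeEnum G l r) : E ↪ Sym2 V where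
  toFun e := s(l e, r e)
  inj' e f hef := by
    rcases Sym2.eq_iff.1 hef with ⟨h1, h2⟩ | ⟨h1, -⟩
    · exact h.ext e f h1 h2
    · exact (h.left_ne_right e f h1).elim

lemma IsEdgeEnum.range_edge (h : IsEdgeEnum G l r) : Set.range h.edge = G.edgeSet := by
  ext e
  induction e with
  | _ x y =>
    rw [SimpleGraph.mem_edgeSet]
    constructor
    · rintro ⟨e, he⟩
      rw [← SimpleGraph.mem_edgeSet, ← he]
      exact h.adj e
    · intro hxy
      obtain ⟨e, ⟨rfl, rfl⟩ | ⟨rfl, rfl⟩⟩ := h.exists_eq x y hxy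
      · exact ⟨e, rfl⟩
      · exact ⟨e, Sym2.eq_swap⟩

/-- The edges of the two-fold cover of `G` with signs `σ`. -/
def IsEdgeEnum.liftEdge (h : IsEdgeEnum G l r) (σ : Sym2 V → Bool) :
    E × Bool ↪ Sym2 (V × Bool) where
  toFun p := s((l p.1, p.2), (r p.1, p.2 ^^ σ s(l p.1, r p.1)))
  inj' p q hpq := by
    rcases Sym2.eq_iff.1 hpq with ⟨h1, h2⟩ | ⟨h1, -⟩
    · exact Prod.ext (h.ext _ _ (Prod.mk.inj h1).1 (Prod.mk.inj h2).1) (Prod.mk.inj h1).2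
    · exact (h.left_ne_right _ _ (Prod.mk.inj h1).1).elim

lemma IsEdgeEnum.range_liftEdge (h : IsEdgeEnum G l r) (σ : Sym2 V → Bool) :
    Set.range (h.liftEdge σ) = (twoLift G σ).edgeSet := by
  ext e
  induction e with
  | _ x y =>
    rw [SimpleGraph.mem_edgeSet]
    constructor
    · rintro ⟨p, hp⟩
      rw [← SimpleGraph.mem_edgeSet, ← hp]
      exact ⟨h.adj p.1, rfl⟩
    · rintro ⟨h1, h2⟩
      obtain ⟨x, a⟩ := x
      obtain ⟨y, b⟩ := y
      simp only at h1 h2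
      obtain ⟨e, ⟨rfl, rfl⟩ | ⟨rfl, rfl⟩⟩ := h.exists_eq x y h1
      · exact ⟨(e, a), by rw [h2]; rfl⟩
      · refine ⟨(e, b), Eq.trans ?_ Sym2.eq_swap⟩
        have : a = (b ^^ σ s(l e, r e)) := by
          rw [h2, Sym2.eq_swap]
          simp
        rw [this]
        rfl

variable [Fintype V] [Fintype E]

open Classical in
lemma IsEdgeEnum.partFun_twoLift (h : IsEdgeEnum G l r) (σ : Sym2 V → Bool) (t : ℝ) :
    partFun (twoLift G σ) 1 t Finset.univ = ∑ N : Finset (E × Bool) with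
      IsLiftMatching l r (fun e => σ s(l e, r e)) N, t ^ N.card := by
  rw [partFun_one_eq_sum (h.liftEdge σ) (h.range_liftEdge σ)]
  refine Finset.sum_congr (Finset.ext fun N => ?_) fun _ _ => rfl
  simp only [Finset.mem_filter, Finset.mem_univ, true_and]
  refine forall₂_congr fun p _ => forall₂_congr fun q _ => imp_congr_right fun _ => ?_
  change (∀ x ∈ s((l p.1, p.2), (r p.1, p.2 ^^ σ s(l p.1, r p.1))),
    x ∉ s((l q.1, q.2), (r q.1, q.2 ^^ σ s(l q.1, r q.1)))) ↔ _
  have h1 := h.left_ne_right p.1 q.1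
  have h2 := h.left_ne_right q.1 p.1
  simp only [Sym2.mem_iff, forall_eq_or_imp, forall_eq, Prod.mk.injEq, h1, h2.symm,
    false_and, or_false, false_or, not_and, ne_eq]

open Classical in
lemma IsEdgeEnum.partFun_sq (h : IsEdgeEnum G l r) (t : ℝ) :
    partFun G 1 t Finset.univ ^ 2 = ∑ N : Finset (E × Bool) with
      IsLiftMatching l r (fun _ => false) N, t ^ N.card := by
  rw [partFun_one_eq_sum h.edge h.range_edge, sq, Finset.sum_mul_sum, ← Finset.sum_product']
  have hP : ∀ N : Finset E, (∀ p ∈ N, ∀ q ∈ N, p ≠ q → ∀ x ∈ h.edge p, x ∉ h.edge q) ↔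
      ∀ p ∈ N, ∀ q ∈ N, p ≠ q → l p ≠ l q ∧ r p ≠ r q := by
    intro N
    refine forall₂_congr fun p _ => forall₂_congr fun q _ => imp_congr_right fun _ => ?_
    change (∀ x ∈ s(l p, r p), x ∉ s(l q, r q)) ↔ _
    have h1 := h.left_ne_right p q
    have h2 := h.left_ne_right q p
    simp [h1, h2.symm]
  have hcard : ∀ A B : Finset E, (A ×ˢ {true} ∪ B ×ˢ {false} : Finset (E × Bool)).card =
      A.card + B.card := by
    intro A B
    rw [Finset.card_union_of_disjoint]
    · simp
    · refine Finset.disjoint_left.2 fun p hp hq => ?_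
      simp only [Finset.mem_product, Finset.mem_singleton] at hp hq
      exact Bool.noConfusion (hp.2.symm.trans hq.2)
  refine Finset.sum_bij' (fun P _ => P.1 ×ˢ {true} ∪ P.2 ×ˢ {false})
    (fun N _ => (Finset.univ.filter fun e => (e, true) ∈ N,
      Finset.univ.filter fun e => (e, false) ∈ N)) ?_ ?_ ?_ ?_ ?_
  · rintro ⟨A, B⟩ h
    simp only [Finset.mem_product, Finset.mem_filter, Finset.mem_univ, true_and, hP] at h ⊢
    rintro ⟨e, a⟩ hp ⟨f, b⟩ hq hpq
    have h1 := h.1 e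
    have h2 := h.2 e
    cases a <;> cases b <;> simp_all
  · intro N hN
    simp only [Finset.mem_product, Finset.mem_filter, Finset.mem_univ, true_and, hP] at hN ⊢
    constructor <;> intro p hp q hq hpq <;>
    · have := hN _ hp _ hq fun h => hpq (Prod.mk.inj h).1
      simpa using this
  · rintro ⟨A, B⟩ _
    ext e <;> simp
  · intro N _
    ext ⟨e, a⟩
    cases a <;> simp
  · rintro ⟨A, B⟩ _
    simp only [hcard, pow_add]

end EdgeEnum

open Classical in
/-- For bipartite `G` the matching generating function of a two-fold cover is at most that of two
disjoint copies of `G`. -/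
lemma partFun_twoLift_le {V : Type u} [Fintype V] {G : SimpleGraph V} {c : V → Bool}
    (hc : ∀ x y, G.Adj x y → c x ≠ c y) (σ : Sym2 V → Bool) {t : ℝ} (ht : 0 ≤ t) :
    partFun (twoLift G σ) 1 t Finset.univ ≤ partFun G 1 t Finset.univ ^ 2 := by
  have h : IsEdgeEnum G (E := {p : V × V // G.Adj p.1 p.2 ∧ c p.1 = false})
      (fun e => e.1.1) (fun e => e.1.2) := by
    refine ⟨fun e f h => ?_, fun e f h h' => Subtype.ext (Prod.ext h h'), fun e => e.2.1,
      fun x y h => ?_⟩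
    · have := hc _ _ f.2.1
      rw [f.2.2, ← h, e.2.2] at this
      exact this rfl
    · cases hx : c x with
      | false => exact ⟨⟨(x, y), h, hx⟩, Or.inl ⟨rfl, rfl⟩⟩
      | true =>
        have := hc _ _ h
        rw [hx] at this
        exact ⟨⟨(y, x), h.symm, by simpa using this.symm⟩, Or.inr ⟨rfl, rfl⟩⟩
  rw [h.partFun_twoLift, h.partFun_sq]
  exact sum_isLiftMatching_le _ _ _ ht

end LiftMatchings

/-! ### The Coulson integral formula -/

section CoulsonIntegral

lemma integrableOn_log_one_add_sq_div :
    IntegrableOn (fun u : ℝ => Real.log (1 + u ^ 2) / u ^ 2) (Set.Ioi 0) := by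
  have hm : Measurable fun u : ℝ => Real.log (1 + u ^ 2) / u ^ 2 := by fun_prop
  have h0 : ∀ u : ℝ, 0 ≤ Real.log (1 + u ^ 2) / u ^ 2 := fun u =>
    div_nonneg (Real.log_nonneg (by nlinarith [sq_nonneg u])) (sq_nonneg u)
  rw [← Set.Ioc_union_Ioi_eq_Ioi (zero_le_one (α := ℝ))]
  refine IntegrableOn.union ?_ ?_
  · refine Integrable.mono' (g := fun _ => (1 : ℝ)) (integrableOn_const (by simp))
      hm.aestronglyMeasurable (ae_of_all _ fun u => ?_)
    rw [Real.norm_of_nonneg (h0 u)]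
    refine div_le_one_of_le₀ ?_ (sq_nonneg u)
    have := Real.log_le_sub_one_of_pos (show (0 : ℝ) < 1 + u ^ 2 by positivity)
    linarith
  · refine Integrable.mono' (g := fun u : ℝ => 4 * 2 ^ (1 / 2 : ℝ) * u ^ (-(3 / 2) : ℝ))
      ((integrableOn_Ioi_rpow_of_lt (by norm_num) one_pos).const_mul _)
      hm.aestronglyMeasurable ?_
    filter_upwards [ae_restrict_mem measurableSet_Ioi] with u hu
    have hu1 : (1 : ℝ) < u := hu
    have hu0 : 0 < u := by linarith
    rw [Real.norm_of_nonneg (h0 u), div_le_iff₀ (by positivity)]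
    have h1 : Real.log (1 + u ^ 2) ≤ Real.log ((2 * u) ^ 2) :=
      Real.log_le_log (by positivity) (by nlinarith)
    have h2 := Real.log_le_rpow_div (show 0 ≤ 2 * u by positivity)
      (show (0 : ℝ) < 1 / 2 by norm_num)
    have h3 : u ^ (-(3 / 2) : ℝ) * u ^ 2 = u ^ (1 / 2 : ℝ) := by
      rw [← Real.rpow_natCast u 2, ← Real.rpow_add hu0]
      norm_num
    rw [Real.log_pow] at h1
    rw [Real.mul_rpow zero_le_two hu0.le] at h2
    rw [mul_assoc, h3]
    push_cast at h1
    linarith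

/-- The constant of the Coulson integral formula (its value is `π`). -/
noncomputable def coulsonConst : ℝ := ∫ u in Set.Ioi (0 : ℝ), Real.log (1 + u ^ 2) / u ^ 2

lemma coulsonConst_pos : 0 < coulsonConst := by
  rw [coulsonConst, setIntegral_pos_iff_support_of_nonneg_ae
    (ae_of_all _ fun u => div_nonneg (Real.log_nonneg (by nlinarith [sq_nonneg u])) (sq_nonneg u))
    integrableOn_log_one_add_sq_div]
  refine lt_of_lt_of_le ?_ (measure_mono (s := Set.Ioi (0 : ℝ)) fun u (hu : 0 < u) => ⟨?_, hu⟩)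
  · simp
  · exact (div_pos (Real.log_pos (by nlinarith)) (by positivity)).ne'

/-- The Coulson integral formula, obtained by substituting `u = |z| t`. -/
lemma coulson_integral (z : ℝ) :
    IntegrableOn (fun t : ℝ => Real.log (1 + t ^ 2 * z ^ 2) / t ^ 2) (Set.Ioi 0) ∧
      ∫ t in Set.Ioi (0 : ℝ), Real.log (1 + t ^ 2 * z ^ 2) / t ^ 2 = coulsonConst * |z| := by
  rcases eq_or_ne z 0 with rfl | hz
  · simp
  have hz' : 0 < |z| := abs_pos.2 hz
  have h : (fun t : ℝ => Real.log (1 + t ^ 2 * z ^ 2) / t ^ 2) =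
      fun t => z ^ 2 * (Real.log (1 + (|z| * t) ^ 2) / (|z| * t) ^ 2) := by
    funext t
    rw [mul_pow, sq_abs, mul_comm (t ^ 2)]
    rcases eq_or_ne t 0 with rfl | ht
    · simp
    · field_simp
  rw [h]
  constructor
  · refine Integrable.const_mul ?_ _
    have := (integrableOn_Ioi_comp_mul_left_iff
      (fun u : ℝ => Real.log (1 + u ^ 2) / u ^ 2) 0 hz').2
    rw [mul_zero] at this
    exact this integrableOn_log_one_add_sq_div
  · rw [integral_const_mul, integral_comp_mul_left_Ioi
      (fun u : ℝ => Real.log (1 + u ^ 2) / u ^ 2) 0 hz', mul_zero, ← coulsonConst, smul_eq_mul,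
      ← sq_abs]
    field_simp

lemma coulson_integral_multiset (s : Multiset ℝ) :
    IntegrableOn (fun t : ℝ => (s.map fun z => Real.log (1 + t ^ 2 * z ^ 2) / t ^ 2).sum)
        (Set.Ioi 0) ∧
      ∫ t in Set.Ioi (0 : ℝ), (s.map fun z => Real.log (1 + t ^ 2 * z ^ 2) / t ^ 2).sum =
        coulsonConst * (s.map fun z => |z|).sum := by
  induction s using Multiset.induction with
  | empty => simp
  | cons a s ih =>
    obtain ⟨h1, h2⟩ := coulson_integral a
    simp only [Multiset.map_cons, Multiset.sum_cons]
    exact ⟨h1.add ih.1, by rw [integral_add h1 ih.1, h2, ih.2, mul_add]⟩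

end CoulsonIntegral

/-! ### Matching energy and two-fold covers -/

section Energy

variable {V : Type u} [Fintype V] (G : SimpleGraph V)

lemma partFun_homogeneous {R : Type*} [CommSemiring R] (a x y : R) :
    partFun G (a * x) (a ^ 2 * y) Finset.univ =
      a ^ Fintype.card V * partFun G x y Finset.univ := by
  rw [partFun, partFun, Finset.mul_sum]
  refine Finset.sum_congr rfl fun M hM => ?_
  rw [← card_uncovered_add (mem_matchingsIn.1 hM)]
  ring

/-- The matching generating function in terms of the zeros of the matching polynomial: evaluate the
latter at `1 / (it)` and take absolute values. -/
lemma partFun_one_sq_eq_prod {t : ℝ} (ht : 0 < t) : partFun G 1 (t ^ 2) Finset.univ ^ 2 =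
    ((matchingPoly G).roots.map fun z => 1 + t ^ 2 * z ^ 2).prod := by
  have ht' : (t : ℂ) ≠ 0 := Complex.ofReal_ne_zero.2 ht.ne'
  have hI : Complex.I * t ≠ 0 := mul_ne_zero Complex.I_ne_zero ht'
  have h1 : ((partFun G 1 (t ^ 2) Finset.univ : ℝ) : ℂ) =
      ((matchingPoly G).roots.map fun z : ℝ => 1 - Complex.I * t * z).prod := by
    have h2 : ((partFun G 1 (t ^ 2) Finset.univ : ℝ) : ℂ) =
        partFun G ((Complex.I * t) * (Complex.I * t)⁻¹) ((Complex.I * t) ^ 2 * (-1))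
          Finset.univ := by
      rw [← Complex.ofRealHom_eq_coe, map_partFun, mul_inv_cancel₀ hI, mul_pow, Complex.I_sq]
      simp
    have h4 : ∀ x : ℂ, Polynomial.aeval x (matchingPoly G) =
        ((matchingPoly G).roots.map fun z : ℝ => x - z).prod := by
      intro x
      conv_lhs => rw [(splits_matchingPoly G).eq_prod_roots_of_monic (monic_matchingPoly G),
        map_multiset_prod, Multiset.map_map]
      simp
    have h5 : ((matchingPoly G).roots.map fun z : ℝ => 1 - Complex.I * t * z).prod =
        ((matchingPoly G).roots.map fun z : ℝ =>
          (Complex.I * t) * ((Complex.I * t)⁻¹ - z)).prod :=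
      congrArg Multiset.prod (Multiset.map_congr rfl fun z _ => by
        rw [mul_sub, mul_inv_cancel₀ hI])
    rw [h2, partFun_homogeneous, ← aeval_matchingPoly, h4, h5, Multiset.prod_map_mul,
      Multiset.map_const', Multiset.prod_replicate, card_roots_matchingPoly G]
  have h3 := congrArg Complex.normSq h1
  rw [Complex.normSq_ofReal, map_multiset_prod, Multiset.map_map, ← sq] at h3
  rw [h3]
  refine congrArg Multiset.prod (Multiset.map_congr rfl fun z _ => ?_)
  simp [Complex.normSq_apply]
  ring

lemma one_le_partFun_one {t : ℝ} (ht : 0 ≤ t) : 1 ≤ partFun G 1 t Finset.univ := by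
  have h : (∅ : Finset (Sym2 V)) ∈ matchingsIn G Finset.univ := by simp [IsMatchingIn]
  refine le_trans ?_ (Finset.single_le_sum (fun M _ => by positivity) h)
  simp

/-- The matching energy as an integral of the logarithm of the matching generating function. -/
lemma coulson_matchingMeasure :
    IntegrableOn (fun t : ℝ => Real.log (partFun G 1 (t ^ 2) Finset.univ) / t ^ 2) (Set.Ioi 0) ∧
      coulsonConst * ∫ z, |z| ∂(matchingMeasure G) = (Fintype.card V : ℝ)⁻¹ *
        (2 * ∫ t in Set.Ioi (0 : ℝ), Real.log (partFun G 1 (t ^ 2) Finset.univ) / t ^ 2) := by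
  obtain ⟨h1, h2⟩ := coulson_integral_multiset (matchingPoly G).roots
  have heq : Set.EqOn (fun t : ℝ => ((matchingPoly G).roots.map fun z =>
      Real.log (1 + t ^ 2 * z ^ 2) / t ^ 2).sum)
      (fun t => 2 * (Real.log (partFun G 1 (t ^ 2) Finset.univ) / t ^ 2)) (Set.Ioi 0) := by
    intro t ht
    have h := congrArg Real.log (partFun_one_sq_eq_prod G ht)
    rw [Real.log_pow, Real.log_multiset_prod, Multiset.map_map] at h
    · simp only
      rw [Multiset.sum_map_div, ← mul_div_assoc]
      push_cast at h
      rw [h]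
      rfl
    · intro x hx
      obtain ⟨z, -, rfl⟩ := Multiset.mem_map.1 hx
      positivity
  have h3 := (integrableOn_congr_fun heq measurableSet_Ioi).1 h1
  refine ⟨?_, ?_⟩
  · have := h3.const_mul (1 / 2)
    refine this.congr (ae_of_all _ fun t => ?_)
    ring
  · rw [integral_matchingMeasure, ← integral_const_mul,
      ← setIntegral_congr_fun measurableSet_Ioi heq, h2]
    ring

/-- The normalized matching energy of a bipartite graph does not increase in two-fold covers. -/
lemma integral_abs_twoLift_le [Nonempty V] {G : SimpleGraph V} {c : V → Bool}
    (hc : ∀ x y, G.Adj x y → c x ≠ c y) (σ : Sym2 V → Bool) :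
    ∫ z, |z| ∂(matchingMeasure (twoLift G σ)) ≤ ∫ z, |z| ∂(matchingMeasure G) := by
  obtain ⟨hG, hG'⟩ := coulson_matchingMeasure G
  obtain ⟨hH, hH'⟩ := coulson_matchingMeasure (twoLift G σ)
  refine le_of_mul_le_mul_left ?_ coulsonConst_pos
  have hn : (0 : ℝ) < Fintype.card V := Nat.cast_pos.2 Fintype.card_pos
  have hle : ∫ t in Set.Ioi (0 : ℝ),
      Real.log (partFun (twoLift G σ) 1 (t ^ 2) Finset.univ) / t ^ 2 ≤
      2 * ∫ t in Set.Ioi (0 : ℝ), Real.log (partFun G 1 (t ^ 2) Finset.univ) / t ^ 2 := by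
    rw [← integral_const_mul]
    refine setIntegral_mono_on hH (hG.const_mul 2) measurableSet_Ioi fun t _ => ?_
    have h1 : 0 < partFun (twoLift G σ) 1 (t ^ 2) Finset.univ :=
      one_pos.trans_le (one_le_partFun_one _ (sq_nonneg t))
    have h2 := Real.log_le_log h1 (partFun_twoLift_le hc σ (sq_nonneg t))
    rw [Real.log_pow] at h2
    rw [← mul_div_assoc]
    exact div_le_div_of_nonneg_right (by exact_mod_cast h2) (sq_nonneg t)
  rw [hG', hH', Fintype.card_prod, Fintype.card_bool]
  push_cast
  rw [mul_inv, mul_assoc]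
  refine mul_le_mul_of_nonneg_left ?_ (inv_nonneg.2 hn.le)
  linarith

end Energy

/-! ### Isomorphism invariance -/

section Isomorphism

lemma IsKMatching.map {V : Type u} {W : Type v} {G : SimpleGraph V} {H : SimpleGraph W}
    (φ : G ≃g H) {k : ℕ} {M : Finset (Sym2 V)} (hM : IsKMatching G k M) :
    IsKMatching H k (M.map ⟨Sym2.map φ, Sym2.map.injective φ.injective⟩) := by
  obtain ⟨h1, h2, h3⟩ := hM
  refine ⟨fun e he => ?_, by rw [Finset.card_map, h2], fun e he f hf hef x hxe hxf => ?_⟩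
  · obtain ⟨e, he', rfl⟩ := Finset.mem_map.1 he
    have := h1 e he'
    induction e with
    | _ a b => exact φ.map_adj_iff.2 this
  · obtain ⟨e, he', rfl⟩ := Finset.mem_map.1 he
    obtain ⟨f, hf', rfl⟩ := Finset.mem_map.1 hf
    obtain ⟨a, ha, rfl⟩ := Sym2.mem_map.1 hxe
    obtain ⟨b, hb, hab⟩ := Sym2.mem_map.1 hxf
    obtain rfl := φ.injective hab
    exact h3 e he' f hf' (fun h => hef (by rw [h])) b ha hb

lemma matchingCount_le_of_iso {V : Type u} {W : Type v} [Finite W] {G : SimpleGraph V}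
    {H : SimpleGraph W} (φ : G ≃g H) (k : ℕ) : matchingCount G k ≤ matchingCount H k :=
  Set.ncard_le_ncard_of_injOn _ (fun _ hM => IsKMatching.map φ hM)
    (Finset.map_injective _).injOn (Set.toFinite _)

lemma matchingMeasure_congr {V : Type u} {W : Type v} [Fintype V] [Fintype W] {G : SimpleGraph V}
    {H : SimpleGraph W} (φ : G ≃g H) : matchingMeasure G = matchingMeasure H := by
  have hcard : Fintype.card V = Fintype.card W := Fintype.card_congr φ.toEquiv
  have hcount : ∀ k, matchingCount G k = matchingCount H k := fun k =>
    (matchingCount_le_of_iso φ k).antisymm (matchingCount_le_of_iso φ.symm k)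
  simp only [matchingMeasure, matchingPoly, hcard, hcount]

lemma IsRegular.congr {V : Type u} {W : Type v} {G : SimpleGraph V} {H : SimpleGraph W} {d : ℕ}
    (hG : IsRegular G d) (φ : G ≃g H) : IsRegular H d := by
  intro w
  obtain ⟨e⟩ := hG (φ.symm w)
  exact ⟨e.trans (φ.symm.mapNeighborSet w).symm⟩

end Isomorphism

/-! ### Towers of covers -/

section Tower

variable {V : Type u} {G : SimpleGraph V}

/-- Relabelling the coordinates of a lift. -/
def signedLiftCongr {α β : Type v} (e : α ≃ β) (s : β → Sym2 V → Bool) :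
    signedLift G s ≃g signedLift G fun a => s (e a) where
  toEquiv := (Equiv.refl V).prodCongr (e.symm.arrowCongr (Equiv.refl Bool))
  map_rel_iff' {p q} := and_congr_right fun _ =>
    ⟨fun h i => by simpa using h (e.symm i), fun h i => h (e i)⟩

/-- Adding a coordinate to a lift amounts to taking a two-fold cover of it. -/
def signedLiftOption {α : Type v} (s : Option α → Sym2 V → Bool) :
    signedLift G s ≃g twoLift (signedLift G fun a => s (some a))
      fun e => s none (e.map Prod.fst) where
  toFun p := ((p.1, fun a => p.2 (some a)), p.2 none)
  invFun p := (p.1.1, fun a => a.elim p.2 p.1.2)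
  left_inv p := Prod.ext rfl (funext fun a => by cases a <;> rfl)
  right_inv p := rfl
  map_rel_iff' {p q} := by
    constructor
    · rintro ⟨⟨h1, h2⟩, h3⟩
      exact ⟨h1, fun a => by cases a with | none => exact h3 | some a => exact h2 a⟩
    · rintro ⟨h1, h2⟩
      exact ⟨⟨h1, fun a => h2 (some a)⟩, h2 none⟩

/-- The normalized matching energy of a bipartite graph does not increase in iterated two-fold
covers. -/
lemma integral_abs_signedLift_le [Fintype V] [Nonempty V] {c : V → Bool}
    (hc : ∀ x y, G.Adj x y → c x ≠ c y) (ι : Type v) [Finite ι] :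
    ∀ [Fintype (V × (ι → Bool))] (s : ι → Sym2 V → Bool),
      ∫ z, |z| ∂(matchingMeasure (signedLift G s)) ≤ ∫ z, |z| ∂(matchingMeasure G) := by
  classical
  induction ι using Finite.induction_empty_option with
  | of_equiv e ih =>
    intro _ s
    rename_i α β _
    let _ : Fintype (V × (α → Bool)) :=
      Fintype.ofEquiv _ (signedLiftCongr (G := G) e s).toEquiv
    rw [matchingMeasure_congr (signedLiftCongr e s)]
    exact ih _
  | h_empty =>
    intro _ s
    let φ : signedLift G s ≃g G :=
      ⟨Equiv.prodUnique V (PEmpty → Bool),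
        fun {p q} => ⟨fun h => ⟨h, fun i => i.elim⟩, fun h => h.1⟩⟩
    rw [matchingMeasure_congr φ]
  | h_option ih =>
    intro _ s
    rw [matchingMeasure_congr (signedLiftOption s)]
    exact (integral_abs_twoLift_le (G := signedLift G fun a => s (some a))
      (c := fun p => c p.1) (fun x y h => hc _ _ h.1) _).trans (ih _)

/-- Regular graphs have covers of arbitrarily large girth; for a bipartite graph these can be
chosen without increasing the normalized matching energy. -/
lemma exists_cover_noShortCycle {V : Type} [Fintype V] [Nonempty V] {G : SimpleGraph V} {d : ℕ}
    (hG : IsRegular G d) (n : ℕ) :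
    ∃ (W : Type) (_ : Fintype W) (_ : Nonempty W) (H : SimpleGraph W),
      IsRegular H d ∧ NoShortCycle H n ∧ ((∃ c : V → Bool, ∀ x y, G.Adj x y → c x ≠ c y) →
        (∃ c : W → Bool, ∀ x y, H.Adj x y → c x ≠ c y) ∧
        ∫ z, |z| ∂(matchingMeasure H) ≤ ∫ z, |z| ∂(matchingMeasure G)) := by
  classical
  induction n with
  | zero =>
    exact ⟨V, inferInstance, inferInstance, G, hG, fun x l h0 h => absurd h0 (by omega),
      fun hc => ⟨hc, le_rfl⟩⟩
  | succ n ih =>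
    obtain ⟨W, _, _, H, h1, h2, h3⟩ := ih
    refine ⟨W × (Sym2 W → Bool), inferInstance, inferInstance, _, h1.signedLift _, h2.signedLift,
      fun hc => ?_⟩
    obtain ⟨⟨c, hc⟩, hle⟩ := h3 hc
    exact ⟨⟨fun p => c p.1, fun x y h => hc _ _ h.1⟩,
      (integral_abs_signedLift_le hc _ _).trans hle⟩

end Tower

/-! ### The regular tree as a limit -/

section Conclusion

lemma isRegular_top (d : ℕ) : IsRegular (⊤ : SimpleGraph (Fin (d + 1))) d := fun v =>
  ⟨(finSuccAboveEquiv v).trans (Equiv.subtypeEquivRight fun x => by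
    simp [eq_comm])⟩

/-- Every regular graph has a sequence of covers that converges to the regular tree; for a bipartite
graph these do not have larger normalized matching energy. -/
lemma exists_bsConverges_regularTree {V : Type} [Fintype V] [Nonempty V] {G : SimpleGraph V} {d : ℕ}
    (hG : IsRegular G d) :
    ∃ (W : ℕ → Type) (_ : ∀ i, Fintype (W i)) (_ : ∀ i, Nonempty (W i))
      (H : ∀ i, SimpleGraph (W i)), BSConverges H (regularTree d) (regularTreeRoot d) ∧
        ((∃ c : V → Bool, ∀ x y, G.Adj x y → c x ≠ c y) →
          ∀ i, ∫ z, |z| ∂(matchingMeasure (H i)) ≤ ∫ z, |z| ∂(matchingMeasure G)) := by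
  choose W hW hW' H h1 h2 h3 using exists_cover_noShortCycle hG
  exact ⟨W, hW, hW', H, bsConverges_regularTree h1 h2, fun hc i => (h3 i hc).2⟩

lemma exists_fin_ballIso_regularTree (d r : ℕ) :
    ∃ (n : ℕ) (A : SimpleGraph (Fin n)) (a : Fin n),
      BallIso (regularTree d) (regularTreeRoot d) r A a := by
  obtain ⟨W, _, ⟨o⟩, H, h1, h2, -⟩ := exists_cover_noShortCycle (isRegular_top d) (2 * r + 1)
  obtain ⟨n, A, a, h⟩ := exists_fin_ballIso (r := r) H o
  exact ⟨n, A, a, (ballIso_iff h1 h2 o A a).1 h⟩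

end Conclusion

end MatchingEnergy


theorem mainTheorem10 (d : ℕ) :
    (∃! ρ : MeasureTheory.Measure ℝ,
      MatchingEnergy.IsLimitMatchingMeasure
        (MatchingEnergy.regularTree d) (MatchingEnergy.regularTreeRoot d) ρ) ∧
    ∀ ρ : MeasureTheory.Measure ℝ,
      MatchingEnergy.IsLimitMatchingMeasure
        (MatchingEnergy.regularTree d) (MatchingEnergy.regularTreeRoot d) ρ →
      MeasureTheory.Integrable (fun z : ℝ => |z|) ρ ∧
      ∀ {V : Type*} [Fintype V] [Nonempty V] (G : SimpleGraph V) [G.LocallyFinite],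
        G.IsBipartite → G.IsRegularOfDegree d →
          ∫ z, |z| ∂(MatchingEnergy.matchingMeasure G) ≥ ∫ z, |z| ∂ρ := by
  open MatchingEnergy in
  obtain ⟨W, _, _, H, hH, -⟩ := exists_bsConverges_regularTree (isRegular_top d)
  refine ⟨existsUnique_isLimitMatchingMeasure (exists_fin_ballIso_regularTree d) hH,
    fun ρ hρ => ⟨?_, fun {V} _ _ G _ hbip hreg => ?_⟩⟩
  · -- Along a sequence of bounded degree the zeros are uniformly bounded.
    obtain ⟨D, hD⟩ := hH.1
    refine (hρ.integral_abs_le hH (c := D + 1) fun i => ?_).1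
    have := isProbabilityMeasure_matchingMeasure (H i)
    refine (integral_matchingMeasure_le (H i) (g := fun _ => (D : ℝ) + 1) fun z hz =>
      abs_le_of_mem_roots (degreeLE_of_ncard_le (hD i)) hz).trans ?_
    simp
  · -- `G` may live in any universe, while the sequences in the definition consist of small types.
    have φ : G ≃g G.map (Fintype.equivFin V).toEmbedding := SimpleGraph.Iso.map _ G
    have : Nonempty (Fin (Fintype.card V)) := ⟨Fintype.equivFin V (Classical.arbitrary V)⟩
    have hG : IsRegular G d := fun v => ⟨(Fintype.equivFinOfCardEq (by
      rw [SimpleGraph.card_neighborSet_eq_degree, hreg.degree_eq])).symm⟩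
    obtain ⟨c⟩ := hbip
    obtain ⟨W, _, _, H, hH, hle⟩ := exists_bsConverges_regularTree (hG.congr φ)
    rw [matchingMeasure_congr φ]
    refine (hρ.integral_abs_le hH (hle ⟨fun x => decide (c (φ.symm x) = 0), fun x y h => ?_⟩)).2
    have hb : ∀ a b : Fin 2, a ≠ b → decide (a = 0) ≠ decide (b = 0) := by decide
    exact hb _ _ (c.valid (φ.symm.map_adj_iff.2 h))
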